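/- **Setting.** Let $\Omega\subset\mathbb R^2$ be a polygonal domain (open, connected, bounded, equal to the interior of its closure), and let $\mathcal T_h$ be a conforming triangulation of it, with vertex set $\mathcal S_h$. For $z\in\mathcal S_h$ let $\mathcal T_h(z)$ be the set of triangles having $z$ as a vertex and $\Omega_h(z)$ their union. The triangulation is shape regular with constant $\rho>0$: every $T\in\mathcal T_h$ contains a disc of diameter at least $\rho\,\mathrm{diam}\,T$. At each $z\in\mathcal S_h$ the triangles can be enumerated as $\mathcal T_h(z)=\{T_1,\dots,T_N\}$ so that $T_j,T_{j+1}$ share an edge at $z$ for $1\le j\le N-1$ and, moreover, $T_N,T_1$ share an edge at $z$ if $z$ is an interior vertex, while $T_1$ and $T_N$ have boundary edges at $z$ if $z$ is a boundary vertex (so $\partial\Omega$ has no pinch points); fix such enumerations. Let $\theta_j$ be the angle of $T_j$ at $z$, and set $$\Gamma(z)=\max_j|\theta_j+\theta_{j+1}-\pi|,\qquad \Theta(z)=\max_j|\sin(\theta_j+\theta_{j+1})|,$$ where $j$ runs over $1,\dots,N$ with $\theta_{N+1}=\theta_1$ if $z$ is an interior vertex, and over $1,\dots,N-1$ if $z$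 is a boundary vertex; an empty maximum is $0$. The vertex $z$ is singular if $\Gamma(z)=0$ and non-singular if $\Gamma(z)>0$. For $k\ge1$ let $$V_h^k=\{v\in[C_0(\Omega)]^2: v|_T\in[P^k(T)]^2\ \ \forall T\in\mathcal T_h\},$$ $$Q_h^{k-1}=\Big\{q\in L^2_0(\Omega): q|_T\in P^{k-1}(T)\ \ \forall T\in\mathcal T_h,\ \ \sum_{j=1}^N(-1)^{N-j}q|_{T_j}(z)=0\ \text{ for every singular } z\in\mathcal S_h\Big\},$$ where $C_0(\Omega)$ is the space of continuous functions vanishing on $\partial\Omega$ (extended by zero outside $\Omega$), $P^k(T)$ is the space of polynomials of degree at most $k$ on $T$, $L^2_0(\Omega)$ is the space of $L^2$ functions with mean zero on $\Omega$, and for a piecewise polynomial $q$ the value $q|_T(z)$ is the limit of $q$ at $z$ from the interior of $T$. **Lemma 3.4.** For every $k\ge 1$ and $\rho>0$ there is a constant $C>0$, depending only on $k$ and $\rho$, such that for every $\Omega$ and $\mathcal T_h$ as above, every $p\in Q_h^{k-1}$ and every $z\in\mathcal S_h$ there exists a vector field $v$ with 1. $(\operatorname{div}v)|_T(\sigma)=0$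 for every $T\in\mathcal T_h$ and every vertex $\sigma\ne z$ of $T$; 2. $(\operatorname{div}v)|_T(z)=p|_T(z)$ for every $T\in\mathcal T_h(z)$; 3. $\operatorname{supp}v\subset\Omega_h(z)$; 4. $\int_K\operatorname{div}v\,dx=0$ for every $K\in\mathcal T_h$. If $z$ is singular, then $v\in V_h^3$ and $\|\nabla v\|_{L^2(\Omega_h(z))}\le C\,\|p\|_{L^2(\Omega_h(z))}$. If $z$ is non-singular, then $v\in V_h^4$ and $$\|\nabla v\|_{L^2(\Omega_h(z))}\le C\Big(\frac1{\Theta(z)}+1\Big)\|p\|_{L^2(\Omega_h(z))}.$$ -/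

import Mathlib

open MeasureTheory Topology

namespace ScottVogelius

noncomputable section

/-- The Euclidean plane. -/
abbrev Plane : Type := EuclideanSpace ℝ (Fin 2)

/-! ### Domain and triangulation -/

/-- A domain `Ω` without slits: a nonempty, connected, open set equal to the interior of its
closure. That it is polygonal (and bounded) is expressed by `Triangulation Ω`, which writes the
closure of `Ω` as a finite union of triangles. -/
structure IsRegularDomain (Ω : Set Plane) : Prop where
  isOpen : IsOpen Ω
  isConnected : IsConnected Ω
  interior_closure : interior (closure Ω) = Ω

/-- A conforming triangulation of `Ω`: a finite geometric simplicial complex, each of whose faces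
lies in a triangle of the complex, and whose underlying space is the closure of `Ω`. -/
structure Triangulation (Ω : Set Plane) extends Geometry.SimplicialComplex ℝ Plane where
  finite_faces : faces.Finite
  pure : ∀ s ∈ faces, ∃ T ∈ faces, s ⊆ T ∧ T.card = 3
  space_eq : toSimplicialComplex.space = closure Ω

variable {Ω : Set Plane}

namespace Triangulation

/-- The triangles, each given by the set of its three vertices. -/
def triangles (M : Triangulation Ω) : Set (Finset Plane) :=
  {T | T ∈ M.faces ∧ T.card = 3}

/-- The set of vertices of the triangulation. -/
def vertexSet (M : Triangulation Ω) : Set Plane :=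
  M.toSimplicialComplex.vertices

/-- The triangles having `z` as a vertex. -/
def trianglesAt (M : Triangulation Ω) (z : Plane) : Set (Finset Plane) :=
  {T | T ∈ M.triangles ∧ z ∈ T}

/-- The patch of `z`: the union of the (closed) triangles having `z` as a vertex. -/
def patch (M : Triangulation Ω) (z : Plane) : Set Plane :=
  ⋃ T ∈ M.trianglesAt z, convexHull ℝ (T : Set Plane)

/-- Shape regularity with constant `ρ`: every triangle `T` contains a disc of
diameter at least `ρ * diam T`. -/
def ShapeRegular (M : Triangulation Ω) (ρ : ℝ) : Prop :=
  ∀ T ∈ M.triangles, ∃ (c : Plane) (r : ℝ),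
    Metric.closedBall c r ⊆ convexHull ℝ (T : Set Plane) ∧
      ρ * Metric.diam (convexHull ℝ (T : Set Plane)) ≤ 2 * r

end Triangulation

/-! ### Enumeration of the triangles around a vertex -/

open scoped Classical in
/-- The triangle with vertices `z`, `a`, `b`, as a set of vertices. -/
def tri (z a b : Plane) : Finset Plane := {z, a, b}

/-- An enumeration, for every vertex `z`, of the triangles `T₀, …, T_{N-1}` at `z` in consecutive
order. Here `N = num z`, and `T_j` has the vertices `z`, `nbr z j`, `nbr z (j + 1)`, so that `T_j`
and `T_{j+1}` share the edge from `z` to `nbr z (j + 1)`. At an interior vertex `T_{N-1}` and `T₀`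
share an edge as well; at a boundary vertex `T₀` and `T_{N-1}` have boundary edges at `z`. -/
structure VertexEnumeration (M : Triangulation Ω) where
  num : Plane → ℕ
  nbr : Plane → ℕ → Plane
  mem_triangles : ∀ z ∈ M.vertexSet, ∀ j < num z,
    tri z (nbr z j) (nbr z (j + 1)) ∈ M.triangles
  injective : ∀ z ∈ M.vertexSet, ∀ i < num z, ∀ j < num z,
    tri z (nbr z i) (nbr z (i + 1)) = tri z (nbr z j) (nbr z (j + 1)) → i = j
  surjective : ∀ z ∈ M.vertexSet, ∀ T ∈ M.trianglesAt z,
    ∃ j < num z, T = tri z (nbr z j) (nbr z (j + 1))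
  interior_vertex : ∀ z ∈ M.vertexSet, z ∈ Ω → nbr z (num z) = nbr z 0
  boundary_vertex : ∀ z ∈ M.vertexSet, z ∈ frontier Ω →
    segment ℝ z (nbr z 0) ⊆ frontier Ω ∧ segment ℝ z (nbr z (num z)) ⊆ frontier Ω

namespace VertexEnumeration

variable {M : Triangulation Ω}

/-- The `j`-th triangle at `z` (counted from `0`). -/
def triangle (e : VertexEnumeration M) (z : Plane) (j : ℕ) : Finset Plane :=
  tri z (e.nbr z j) (e.nbr z (j + 1))

/-- The angle at `z` of the `j`-th triangle at `z`. -/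
def angle (e : VertexEnumeration M) (z : Plane) (j : ℕ) : ℝ :=
  EuclideanGeometry.angle (e.nbr z j) z (e.nbr z (j + 1))

open scoped Classical in
/-- The number of pairs of consecutive triangles at `z`: at an interior vertex the pair
`(T_{N-1}, T₀)` counts, at a boundary vertex it does not. -/
def numPairs (e : VertexEnumeration M) (z : Plane) : ℕ :=
  if z ∈ Ω then e.num z else e.num z - 1

/-- The sum of the angles at `z` of the `j`-th triangle and of its successor. -/
def angleSum (e : VertexEnumeration M) (z : Plane) (j : ℕ) : ℝ :=
  e.angle z j + e.angle z ((j + 1) % e.num z)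

/-- `Γ(z)`, the maximum of `|θ_j + θ_{j+1} - π|` over consecutive pairs (`0` if there are none). -/
def Gam (e : VertexEnumeration M) (z : Plane) : ℝ :=
  ⨆ j : Fin (e.numPairs z), |e.angleSum z j - Real.pi|

/-- `Θ(z)`, the maximum of `|sin (θ_j + θ_{j+1})|` over consecutive pairs (`0` if there are
none). -/
def Theta (e : VertexEnumeration M) (z : Plane) : ℝ :=
  ⨆ j : Fin (e.numPairs z), |Real.sin (e.angleSum z j)|

/-- The vertex `z` is singular. -/
def IsSingular (e : VertexEnumeration M) (z : Plane) : Prop := e.Gam z = 0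

/-- The vertex `z` is non-singular. -/
def IsNonsingular (e : VertexEnumeration M) (z : Plane) : Prop := 0 < e.Gam z

end VertexEnumeration

/-! ### Piecewise polynomials and differential operators -/

/-- On the set `S` the function `f` agrees with a polynomial of total degree at most `k`. -/
def IsPolyOn (S : Set Plane) (k : ℕ) (f : Plane → ℝ) : Prop :=
  ∃ P : MvPolynomial (Fin 2) ℝ, P.totalDegree ≤ k ∧
    ∀ x ∈ S, f x = MvPolynomial.eval (fun i => x i) P

/-- The value at `x ∈ T` of the restriction `q|_T`: the limit of `q` at `x` from the interior
of `T`. -/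
def valueOn (T : Finset Plane) (q : Plane → ℝ) (x : Plane) : ℝ :=
  extendFrom (interior (convexHull ℝ (T : Set Plane))) q x

/-- The partial derivative `∂_j v_i` at `x`. -/
def partialDeriv (v : Plane → Plane) (i j : Fin 2) (x : Plane) : ℝ :=
  fderiv ℝ v x (EuclideanSpace.single j 1) i

/-- The divergence of `v` (for a piecewise polynomial `v`, used in the interiors of triangles). -/
def divergence (v : Plane → Plane) (x : Plane) : ℝ :=
  ∑ i, partialDeriv v i i x

/-- The `L²` norm on `S` of a scalar function. -/
def normL2 (S : Set Plane) (q : Plane → ℝ) : ℝ :=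
  Real.sqrt (∫ x in S, q x ^ 2)

/-- The `L²` norm on `S` of the gradient of `v`. -/
def gradNormL2 (S : Set Plane) (v : Plane → Plane) : ℝ :=
  Real.sqrt (∫ x in S, ∑ i, ∑ j, partialDeriv v i j x ^ 2)

/-! ### The Scott–Vogelius spaces -/

/-- The space `V_h^k` of continuous vector fields vanishing on the boundary of `Ω` (extended by
zero outside `Ω`) that are polynomial of degree at most `k` on every triangle. -/
def velocitySpace (M : Triangulation Ω) (k : ℕ) : Set (Plane → Plane) :=
  {v | Continuous v ∧ (∀ x, x ∉ Ω → v x = 0) ∧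
    ∀ T ∈ M.triangles, ∀ i, IsPolyOn (convexHull ℝ (T : Set Plane)) k (fun x => v x i)}

/-- The alternating sum `A_h^z(q)` of the values at `z` of `q` on the triangles at `z`. -/
def altSum {M : Triangulation Ω} (e : VertexEnumeration M) (z : Plane) (q : Plane → ℝ) : ℝ :=
  ∑ j ∈ Finset.range (e.num z), (-1) ^ (e.num z - (j + 1)) * valueOn (e.triangle z j) q z

/-- The space of the square-integrable functions on `Ω` with average zero that are polynomial of
degree at most `m` on (the interior of) every triangle and whose alternating sum vanishes at every
singular vertex; `Q_h^{k-1}` is the case `m = k - 1`. -/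
def pressureSpace {M : Triangulation Ω} (e : VertexEnumeration M) (m : ℕ) : Set (Plane → ℝ) :=
  {q | MemLp q 2 (volume.restrict Ω) ∧ ∫ x in Ω, q x = 0 ∧
    (∀ T ∈ M.triangles, IsPolyOn (interior (convexHull ℝ (T : Set Plane))) m q) ∧
    ∀ z ∈ M.vertexSet, e.IsSingular z → altSum e z q = 0}

end

end ScottVogelius

open MeasureTheory Topology

namespace ScottVogelius

noncomputable section

/-! ### Plane geometry -/

/-! Let two triangles share the edge `z y`, put `e = y - z`, and let `s`, `t` be the hat functions
of `z` and `y` on them. The cubic field `s² t e` is continuous, vanishes on the outer edges and is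
tangential to the shared edge. Hence its divergence has mean zero on both triangles; it equals 1 at
`z` on both and 0 at all other vertices. The quartic field `s² t (s - 3/2 t) e^⊥` has a divergence
with the same vanishing properties, since the factor `3/2` makes its flux through the edge vanish.
At `z` its divergence is the derivative of `t` along `e^⊥` (`normalRate`), which jumps across the
edge.

To prescribe values `a j` at `z`, walk through the triangles around `z` and use the tangential field
of each edge crossed to correct the triangle being left. The error that remains on the last triangle
is the alternating sum of the `a j` (`exists_corrector_of_altPart`). At a singular vertex the
pressure space makes this sum zero, so cubic fields suffice.

At a non-singular vertex one more field with nonzero alternating sum is needed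
(`exists_altCorrector`). Consecutive triangles carry opposite signs, so a normal field contributes
the jump of `normalRate`. Up to sign this is `cot θ_j + cot θ_{j+1} = sin (θ_j + θ_{j+1}) / (sin θ_j
sin θ_{j+1})`, which is at least the sine in modulus (`abs_sin_add_le`); the best edge gives at
least `Θ(z)`. The only exception is the closing pair of an odd cycle, where the signs agree and the
tangential field has alternating sum 2. Dividing by the alternating sum produces the factor `1 /
Θ(z)`.

For the norms, gradients are bounded pointwise by coefficients over `ρ`, and coefficients by the
vertex values of `p`. Those are controlled by an inverse inequality and the comparability of the
areas in a patch (`exists_abs_valueOn_le`); the number of triangles at a vertex is bounded by an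
area count (`num_mul_sq_le`). -/

/-- The cross product of two plane vectors. -/
def cross (u v : Plane) : ℝ := u 0 * v 1 - u 1 * v 0

/-- The rotation by a right angle. -/
def rot (u : Plane) : Plane := !₂[-u 1, u 0]

/-- The standard inner product in coordinates. -/
def dotp (u v : Plane) : ℝ := u 0 * v 0 + u 1 * v 1

@[simp] lemma rot_zero (u : Plane) : rot u 0 = -u 1 := rfl
@[simp] lemma rot_one (u : Plane) : rot u 1 = u 0 := rfl

lemma norm_sq_eq (u : Plane) : ‖u‖ ^ 2 = u 0 ^ 2 + u 1 ^ 2 := by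
  rw [EuclideanSpace.norm_sq_eq]; simp [Fin.sum_univ_two]

lemma norm_rot (u : Plane) : ‖rot u‖ = ‖u‖ := by
  rw [← sq_eq_sq₀ (norm_nonneg _) (norm_nonneg _), norm_sq_eq, norm_sq_eq]
  simp; ring

lemma inner_eq_dotp (u v : Plane) : inner ℝ u v = dotp u v := by
  simp [PiLp.inner_apply, Fin.sum_univ_two, dotp]; ring

lemma plane_ext {u v : Plane} (h0 : u 0 = v 0) (h1 : u 1 = v 1) : u = v := by
  ext i; fin_cases i <;> assumption

/-- The linear functional with value `1` at `u` and `0` at `v` (if `cross u v ≠ 0`). -/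
def dual (u v : Plane) : Plane →L[ℝ] ℝ :=
  (cross u v)⁻¹ • (v 1 • EuclideanSpace.proj (0 : Fin 2) - v 0 • EuclideanSpace.proj (1 : Fin 2))

lemma dual_apply (u v h : Plane) : dual u v h = cross h v / cross u v := by
  simp [dual, cross, EuclideanSpace.proj]; ring

lemma cross_swap (u v : Plane) : cross u v = -cross v u := by
  simp only [cross]; ring

lemma dual_left {u v : Plane} (h : cross u v ≠ 0) : dual u v u = 1 := by
  rw [dual_apply, div_self h]

lemma dual_right (u v : Plane) : dual u v v = 0 := by
  rw [dual_apply]; simp [cross, mul_comm]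

lemma dual_expand {u v : Plane} (h : cross u v ≠ 0) (x : Plane) :
    x = dual u v x • u + dual v u x • v := by
  have h' : cross v u ≠ 0 := by rw [cross_swap]; simpa using h
  rw [dual_apply, dual_apply, cross_swap v u]
  apply plane_ext <;> simp only [PiLp.add_apply, PiLp.smul_apply, smul_eq_mul] <;> field_simp <;>
    simp only [cross] <;> ring

/-! ### Triangles -/

lemma coe_tri (z y a : Plane) : (tri z y a : Set Plane) = {z, y, a} := by
  simp [tri]

lemma tri_swap (z y a : Plane) : tri z y a = tri z a y := by
  ext x; simp [tri]; tauto

/-- The two functionals are the barycentric coordinates of `x` belonging to `y` and `a`; the one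
belonging to `z` is what is missing to 1. -/
lemma mem_hull_iff {z y a : Plane} (h : cross (y - z) (a - z) ≠ 0) (x : Plane) :
    x ∈ convexHull ℝ (tri z y a : Set Plane) ↔
      0 ≤ dual (y - z) (a - z) (x - z) ∧ 0 ≤ dual (a - z) (y - z) (x - z) ∧
        dual (y - z) (a - z) (x - z) + dual (a - z) (y - z) (x - z) ≤ 1 := by
  have h' : cross (a - z) (y - z) ≠ 0 := by rw [cross_swap]; simpa using h
  rw [coe_tri]
  constructor
  · intro hx
    have hc : Convex ℝ {x : Plane | 0 ≤ dual (y - z) (a - z) (x - z) ∧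
        0 ≤ dual (a - z) (y - z) (x - z) ∧
        dual (y - z) (a - z) (x - z) + dual (a - z) (y - z) (x - z) ≤ 1} := by
      intro p hp q hq s t hs ht hst
      have e : s • p + t • q - z = s • (p - z) + t • (q - z) := by
        have : z = (s + t) • z := by rw [hst, one_smul]
        nth_rewrite 1 [this]; module
      simp only [Set.mem_ofPred_eq, e, map_add, map_smul, smul_eq_mul] at *
      obtain ⟨h1, h2, h3⟩ := hp
      obtain ⟨h4, h5, h6⟩ := hq
      refine ⟨by positivity, by positivity, ?_⟩
      nlinarith [mul_le_mul_of_nonneg_left h3 hs, mul_le_mul_of_nonneg_left h6 ht]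
    refine convexHull_min ?_ hc hx
    rintro p (rfl | rfl | rfl)
    · simp
    · simp [-map_sub, dual_left h, dual_right]
    · simp [-map_sub, dual_left h', dual_right]
  · rintro ⟨h1, h2, h3⟩
    set s := dual (y - z) (a - z) (x - z) with hs
    set t := dual (a - z) (y - z) (x - z) with ht
    have hx : x = (1 - s - t) • z + s • y + t • a := by
      have := dual_expand h (x - z)
      rw [← hs, ← ht] at this
      have hx : x = z + (x - z) := by abel
      rw [hx, this]; module
    rw [hx]
    have hcv := convex_convexHull ℝ ({z, y, a} : Set Plane)
    have hm := subset_convexHull ℝ ({z, y, a} : Set Plane)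
    have := hcv.sum_mem (t := Finset.univ) (w := ![1 - s - t, s, t]) (z := ![z, y, a])
      (by intro i _; fin_cases i <;> simp <;> linarith)
      (by simp [Fin.sum_univ_three]; ring)
      (by intro i _; fin_cases i <;> simp <;> apply hm <;> simp)
    simpa [Fin.sum_univ_three] using this

lemma isOpen_dual_pos (z y a : Plane) : IsOpen {x : Plane | 0 < dual (y - z) (a - z) (x - z) ∧
    0 < dual (a - z) (y - z) (x - z) ∧
    dual (y - z) (a - z) (x - z) + dual (a - z) (y - z) (x - z) < 1} := by
  have h1 : Continuous fun x : Plane => dual (y - z) (a - z) (x - z) := by fun_prop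
  have h2 : Continuous fun x : Plane => dual (a - z) (y - z) (x - z) := by fun_prop
  exact (isOpen_lt continuous_const h1).inter
    ((isOpen_lt continuous_const h2).inter (isOpen_lt (h1.add h2) continuous_const))

lemma mem_interior_hull {z y a : Plane} (h : cross (y - z) (a - z) ≠ 0) {x : Plane}
    (hx : 0 < dual (y - z) (a - z) (x - z) ∧ 0 < dual (a - z) (y - z) (x - z) ∧
        dual (y - z) (a - z) (x - z) + dual (a - z) (y - z) (x - z) < 1) :
    x ∈ interior (convexHull ℝ (tri z y a : Set Plane)) := by
  refine interior_maximal ?_ (isOpen_dual_pos z y a) hx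
  rintro w ⟨h1, h2, h3⟩
  exact (mem_hull_iff h w).2 ⟨h1.le, h2.le, h3.le⟩

lemma interior_hull_nonempty {z y a : Plane} (h : cross (y - z) (a - z) ≠ 0) :
    (interior (convexHull ℝ (tri z y a : Set Plane))).Nonempty := by
  have h' : cross (a - z) (y - z) ≠ 0 := by rw [cross_swap]; simpa using h
  refine ⟨z + (1 / 3 : ℝ) • (y - z) + (1 / 3 : ℝ) • (a - z), mem_interior_hull h ?_⟩
  have e : z + (1 / 3 : ℝ) • (y - z) + (1 / 3 : ℝ) • (a - z) - z =
    (1 / 3 : ℝ) • (y - z) + (1 / 3 : ℝ) • (a - z) := by abel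
  simp only [e, map_add, map_smul, dual_left h, dual_left h', dual_right]
  norm_num

lemma cross_ne_zero_of_affineIndependent {z y a : Plane} (hc : (tri z y a).card = 3)
    (hi : AffineIndependent ℝ ((↑) : tri z y a → Plane)) : cross (y - z) (a - z) ≠ 0 := by
  intro h0
  have hzy : z ≠ y := by
    rintro rfl
    have : tri z z a = {z, a} := by simp [tri]
    rw [this] at hc
    have := Finset.card_le_two (a := z) (b := a)
    omega
  have h2 := hi.finrank_vectorSpan (n := 2) (by simpa using hc)
  have hcol : Collinear ℝ ({z, y, a} : Set Plane) := by
    rw [collinear_iff_of_mem (p₀ := z) (by simp)]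
    refine ⟨y - z, ?_⟩
    have hn : (y - z) 0 ^ 2 + (y - z) 1 ^ 2 ≠ 0 := by
      rw [← norm_sq_eq]; simpa [sub_eq_zero] using hzy.symm
    rintro p (rfl | rfl | rfl)
    · exact ⟨0, by simp⟩
    · exact ⟨1, by simp⟩
    · refine ⟨dotp (p - z) (y - z) / ((y - z) 0 ^ 2 + (y - z) 1 ^ 2), ?_⟩
      have key : p - z = (dotp (p - z) (y - z) / ((y - z) 0 ^ 2 + (y - z) 1 ^ 2)) • (y - z) := by
        apply plane_ext <;> simp only [PiLp.smul_apply, smul_eq_mul] <;>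
          simp only [cross, dotp] at * <;> field_simp
        · linear_combination (-(y - z) 1) * h0
        · linear_combination ((y - z) 0) * h0
      rw [← key]; simp
  rw [collinear_iff_finrank_le_one] at hcol
  have hr : Set.range ((↑) : tri z y a → Plane) = {z, y, a} := by
    rw [← coe_tri]; ext; simp
  rw [hr] at h2
  omega

/-! ### Relative position of two triangles of the complex -/

namespace Triangulation
variable {Ω : Set Plane} {M : Triangulation Ω}

lemma cross_ne_zero {z y a : Plane} (h : tri z y a ∈ M.triangles) :
    cross (y - z) (a - z) ≠ 0 :=
  cross_ne_zero_of_affineIndependent h.2 (M.indep h.1)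

open scoped Classical in
lemma exists_eq_tri {T : Finset Plane} (h : T ∈ M.triangles) {v : Plane} (hv : v ∈ T) :
    ∃ q r, T = tri v q r := by
  have : (T.erase v).card = 2 := by rw [Finset.card_erase_of_mem hv, h.2]
  obtain ⟨q, r, -, hqr⟩ := Finset.card_eq_two.1 this
  exact ⟨q, r, by rw [← Finset.insert_erase hv, hqr]; rfl⟩

lemma exists_eq_tri' {T : Finset Plane} (h : T ∈ M.triangles) : ∃ v q r, T = tri v q r := by
  obtain ⟨v, hv⟩ := Finset.card_pos.1 (by rw [h.2]; norm_num : 0 < T.card)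
  exact ⟨v, exists_eq_tri h hv⟩

lemma isClosed_hull (T : Finset Plane) : IsClosed (convexHull ℝ (T : Set Plane)) :=
  (T.finite_toSet.isCompact_convexHull ℝ).isClosed

lemma isCompact_hull (T : Finset Plane) : IsCompact (convexHull ℝ (T : Set Plane)) :=
  T.finite_toSet.isCompact_convexHull ℝ

lemma closure_interior_hull {T : Finset Plane} (h : T ∈ M.triangles) :
    closure (interior (convexHull ℝ (T : Set Plane))) = convexHull ℝ (T : Set Plane) := by
  obtain ⟨v, q, r, rfl⟩ := exists_eq_tri' h
  rw [(convex_convexHull ℝ _).closure_interior_eq_closure_of_nonempty_interior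
    (interior_hull_nonempty (cross_ne_zero h)), (isClosed_hull _).closure_eq]

/-- Some vertex `v` of `K` is not in `T`, and conformity puts the intersection of the triangles on
the line `L = 1` through the other two vertices of `K`. An open set cannot lie on it: a small move
towards `v` lowers `L`. -/
lemma interior_disjoint {K T : Finset Plane} (hK : K ∈ M.triangles) (hT : T ∈ M.triangles)
    (hne : K ≠ T) : Disjoint (interior (convexHull ℝ (K : Set Plane)))
      (interior (convexHull ℝ (T : Set Plane))) := by
  classical
  rw [Set.disjoint_left]
  intro x hxK hxT
  have hns : ¬ K ⊆ T := fun hs => hne (Finset.eq_of_subset_of_card_le hs (by rw [hK.2, hT.2]))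
  obtain ⟨v, hvK, hvT⟩ := Finset.not_subset.1 hns
  obtain ⟨q, r, rfl⟩ := exists_eq_tri hK hvK
  have hc := cross_ne_zero hK
  have hc' : cross (r - v) (q - v) ≠ 0 := by rw [cross_swap]; simpa using hc
  set L := dual (q - v) (r - v) + dual (r - v) (q - v) with hL
  have hsub : convexHull ℝ ((tri v q r : Set Plane) ∩ T) ⊆ {x | L (x - v) = 1} := by
    refine convexHull_min ?_ ?_
    · rintro p ⟨hp, hpT⟩
      rw [coe_tri] at hp
      rcases hp with rfl | rfl | rfl
      · exact absurd hpT hvT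
      · simp [-map_sub, hL, dual_left hc, dual_right]
      · simp [-map_sub, hL, dual_left hc', dual_right]
    · intro p hp q hq s t hs ht hst
      have e : s • p + t • q - v = s • (p - v) + t • (q - v) := by
        have : v = (s + t) • v := by rw [hst, one_smul]
        nth_rewrite 1 [this]; module
      simp only [Set.mem_ofPred_eq] at *
      rw [e, map_add, map_smul, map_smul, hp, hq]; simpa using hst
  have hO : ∀ w ∈ interior (convexHull ℝ (tri v q r : Set Plane)) ∩
      interior (convexHull ℝ (T : Set Plane)), L (w - v) = 1 := fun w hw =>
    hsub (M.inter_subset_convexHull hK.1 hT.1 ⟨interior_subset hw.1, interior_subset hw.2⟩)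
  have hcont : Filter.Tendsto (fun ε : ℝ => x + ε • (v - x)) (𝓝[>] 0) (𝓝 x) := by
    have : ContinuousAt (fun ε : ℝ => x + ε • (v - x)) 0 := by fun_prop
    simpa [ContinuousAt] using this.tendsto.mono_left nhdsWithin_le_nhds
  have hev : ∀ᶠ ε : ℝ in 𝓝[>] 0, x + ε • (v - x) ∈
      interior (convexHull ℝ (tri v q r : Set Plane)) ∩ interior (convexHull ℝ (T : Set Plane)) :=
    hcont ((isOpen_interior.inter isOpen_interior).mem_nhds ⟨hxK, hxT⟩)
  obtain ⟨ε, h1, h2⟩ := (hev.and (self_mem_nhdsWithin : ∀ᶠ ε : ℝ in 𝓝[>] 0, 0 < ε)).exists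
  have h3 := hO _ h1
  have h4 := hO x ⟨hxK, hxT⟩
  have e : x + ε • (v - x) - v = (x - v) - ε • (x - v) := by module
  rw [e, map_sub, map_smul, h4] at h3
  simp at h3
  exact absurd h3 (ne_of_gt h2)

lemma hull_disjoint_interior {K T : Finset Plane} (hK : K ∈ M.triangles) (hT : T ∈ M.triangles)
    (hne : K ≠ T) : Disjoint (convexHull ℝ (K : Set Plane))
      (interior (convexHull ℝ (T : Set Plane))) := by
  rw [← closure_interior_hull hK]
  exact (interior_disjoint hK hT hne).closure_left isOpen_interior

/-- Two distinct triangles that share an edge lie on opposite sides of it. -/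
lemma cross_mul_cross_neg {z y a b : Plane} (ha : tri z y a ∈ M.triangles)
    (hb : tri z y b ∈ M.triangles) (hne : tri z y a ≠ tri z y b) :
    cross (y - z) (a - z) * cross (y - z) (b - z) < 0 := by
  by_contra hcon
  have hca := cross_ne_zero ha
  have hcb := cross_ne_zero hb
  have hpos : 0 < cross (y - z) (a - z) * cross (y - z) (b - z) :=
    lt_of_le_of_ne (not_lt.1 hcon) (mul_ne_zero hca hcb).symm
  set e := y - z with he
  -- Leaving the midpoint of the edge in a direction `n` that points to the side of `c` leads into
  -- the triangle `z y c`.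
  have key : ∀ c : Plane, cross e (c - z) ≠ 0 → ∀ n : Plane, 0 < dual (c - z) e n →
      ∀ᶠ ε : ℝ in 𝓝[>] 0, z + (1 / 2 : ℝ) • e + ε • n ∈
        interior (convexHull ℝ (tri z y c : Set Plane)) := by
    intro c hc n hn
    have e1 : ∀ ε : ℝ, z + (1 / 2 : ℝ) • e + ε • n - z = (1 / 2 : ℝ) • e + ε • n := by
      intro ε; abel
    have hlim : Filter.Tendsto (fun ε : ℝ => 1 / 2 + ε * dual e (c - z) n) (𝓝[>] 0)
        (𝓝 (1 / 2)) := by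
      have : ContinuousAt (fun ε : ℝ => 1 / 2 + ε * dual e (c - z) n) 0 := by fun_prop
      simpa [ContinuousAt] using this.tendsto.mono_left nhdsWithin_le_nhds
    have hlim2 : Filter.Tendsto (fun ε : ℝ => 1 / 2 + ε * dual e (c - z) n +
        ε * dual (c - z) e n) (𝓝[>] 0) (𝓝 (1 / 2)) := by
      have : ContinuousAt (fun ε : ℝ => 1 / 2 + ε * dual e (c - z) n +
        ε * dual (c - z) e n) 0 := by fun_prop
      simpa [ContinuousAt] using this.tendsto.mono_left nhdsWithin_le_nhds
    filter_upwards [hlim.eventually (lt_mem_nhds (by norm_num : (0 : ℝ) < 1 / 2)),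
      hlim2.eventually (gt_mem_nhds (by norm_num : (1 / 2 : ℝ) < 1)), self_mem_nhdsWithin]
      with ε h1 h2 h3
    refine mem_interior_hull hc ?_
    rw [← he, e1]
    simp only [map_add, map_smul, smul_eq_mul, dual_left hc, dual_right]
    refine ⟨by simpa using h1, ?_, ?_⟩
    · have : 0 < ε * dual (c - z) e n := mul_pos h3 hn
      simpa using this
    · linarith
  -- The chosen direction is the normal to the edge pointing towards `a`. It points towards `b` as
  -- well if the two cross products have the same sign, and the interiors would then overlap.
  have hd : ∀ c : Plane, dual (c - z) e (cross e (a - z) • rot e) =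
      (e 0 ^ 2 + e 1 ^ 2) * (cross e (a - z) / cross e (c - z)) := by
    intro c
    rw [map_smul, dual_apply, cross_swap (c - z) e]
    have : cross (rot e) e = -(e 0 ^ 2 + e 1 ^ 2) := by simp only [cross, rot_zero, rot_one]; ring
    rw [this, smul_eq_mul, neg_div_neg_eq]; ring
  have hen : 0 < e 0 ^ 2 + e 1 ^ 2 := by
    rcases eq_or_ne (e 0) 0 with h0 | h0
    · rcases eq_or_ne (e 1) 0 with h1 | h1
      · exact absurd (by simp [cross, h0, h1]) hca
      · positivity
    · positivity
  have pa := key a hca (cross e (a - z) • rot e) (by rw [hd, div_self hca]; simpa using hen)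
  have pb := key b hcb (cross e (a - z) • rot e) (by
    rw [hd]
    have : cross e (a - z) / cross e (b - z) =
      cross e (a - z) * cross e (b - z) / cross e (b - z) ^ 2 := by field_simp
    rw [this]; positivity)
  obtain ⟨ε, h1, h2⟩ := (pa.and pb).exists
  exact Set.disjoint_left.1 (interior_disjoint ha hb hne) h1 h2

end Triangulation

/-! ### Piecewise polynomials -/

namespace IsPolyOn
variable {S : Set Plane} {k l : ℕ} {f g : Plane → ℝ}

lemma mono (h : IsPolyOn S k f) (hkl : k ≤ l) : IsPolyOn S l f := by
  obtain ⟨P, h1, h2⟩ := h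
  exact ⟨P, h1.trans hkl, h2⟩

lemma congr (h : IsPolyOn S k f) (hfg : ∀ x ∈ S, g x = f x) : IsPolyOn S k g := by
  obtain ⟨P, h1, h2⟩ := h
  exact ⟨P, h1, fun x hx => (hfg x hx).trans (h2 x hx)⟩

lemma const (c : ℝ) : IsPolyOn S k (fun _ => c) := ⟨MvPolynomial.C c, by simp, by simp⟩

lemma coord (i : Fin 2) : IsPolyOn S 1 (fun x => x i) := ⟨MvPolynomial.X i, by simp, by simp⟩

lemma add (hf : IsPolyOn S k f) (hg : IsPolyOn S k g) : IsPolyOn S k (fun x => f x + g x) := by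
  obtain ⟨P, h1, h2⟩ := hf
  obtain ⟨Q, h3, h4⟩ := hg
  refine ⟨P + Q, (MvPolynomial.totalDegree_add _ _).trans (max_le h1 h3), fun x hx => ?_⟩
  simp [h2 x hx, h4 x hx]

lemma mul (hf : IsPolyOn S k f) (hg : IsPolyOn S l g) :
    IsPolyOn S (k + l) (fun x => f x * g x) := by
  obtain ⟨P, h1, h2⟩ := hf
  obtain ⟨Q, h3, h4⟩ := hg
  refine ⟨P * Q, (MvPolynomial.totalDegree_mul _ _).trans (add_le_add h1 h3), fun x hx => ?_⟩
  simp [h2 x hx, h4 x hx]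

lemma const_mul (c : ℝ) (hf : IsPolyOn S k f) : IsPolyOn S k (fun x => c * f x) :=
  ((const (k := 0) c).mul hf).mono (by simp)

lemma pow (hf : IsPolyOn S k f) (n : ℕ) : IsPolyOn S (n * k) (fun x => f x ^ n) := by
  induction n with
  | zero => simpa using const 1
  | succ n ih => simpa [pow_succ, add_mul] using ih.mul hf

lemma sum {ι : Type*} (s : Finset ι) {F : ι → Plane → ℝ} (h : ∀ i ∈ s, IsPolyOn S k (F i)) :
    IsPolyOn S k (fun x => ∑ i ∈ s, F i x) := by
  classical
  induction s using Finset.induction_on with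
  | empty => simpa using const 0
  | insert i s hi ih =>
    simp only [Finset.sum_insert hi]
    exact (h i (by simp)).add (ih fun j hj => h j (by simp [hj]))

lemma linear (L : Plane →L[ℝ] ℝ) (c : Plane) : IsPolyOn S 1 (fun x => L (x - c)) := by
  have h : ∀ x : Plane, L (x - c) = -L c + (L (EuclideanSpace.single 0 1) * x 0 +
      L (EuclideanSpace.single 1 1) * x 1) := by
    intro x
    have : x = x 0 • EuclideanSpace.single 0 1 + x 1 • EuclideanSpace.single 1 1 := by
      apply plane_ext <;> simp
    conv_lhs => rw [map_sub, this, map_add, map_smul, map_smul]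
    simp only [smul_eq_mul]; ring
  refine IsPolyOn.congr ?_ fun x _ => h x
  exact (const _).add (((coord 0).const_mul _).add ((coord 1).const_mul _))

end IsPolyOn

/-! ### The reference triangle -/

/-- The reference triangle. -/
def refTri : Set Plane := {x | 0 ≤ x 0 ∧ 0 ≤ x 1 ∧ x 0 + x 1 ≤ 1}

/-- The affine parametrization of the triangle with vertices `z`, `y`, `a`. -/
def chart (z y a x : Plane) : Plane := z + (x 0 • (y - z) + x 1 • (a - z))

lemma isCompact_refTri : IsCompact refTri := by
  have hcl : IsClosed refTri := by
    have h0 : Continuous fun x : Plane => x 0 := by fun_prop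
    have h1 : Continuous fun x : Plane => x 1 := by fun_prop
    exact (isClosed_le continuous_const h0).inter ((isClosed_le continuous_const h1).inter
      (isClosed_le (h0.add h1) continuous_const))
  refine Metric.isCompact_of_isClosed_isBounded hcl ?_
  refine (Metric.isBounded_closedBall (x := (0 : Plane)) (r := 1)).subset ?_
  rintro x ⟨h0, h1, h2⟩
  rw [mem_closedBall_zero_iff, ← sq_le_one_iff₀ (norm_nonneg _), norm_sq_eq]
  nlinarith

lemma dual_chart_left {z y a : Plane} (h : cross (y - z) (a - z) ≠ 0) (x : Plane) :
    dual (y - z) (a - z) (chart z y a x - z) = x 0 := by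
  simp [-map_sub, chart, dual_left h, dual_right]

lemma dual_chart_right {z y a : Plane} (h : cross (y - z) (a - z) ≠ 0) (x : Plane) :
    dual (a - z) (y - z) (chart z y a x - z) = x 1 := by
  have h' : cross (a - z) (y - z) ≠ 0 := by rw [cross_swap]; simpa using h
  simp [-map_sub, chart, dual_left h', dual_right]

lemma chart_image {z y a : Plane} (h : cross (y - z) (a - z) ≠ 0) :
    chart z y a '' refTri = convexHull ℝ (tri z y a : Set Plane) := by
  ext x
  rw [mem_hull_iff h]
  constructor
  · rintro ⟨w, hw, rfl⟩
    rw [dual_chart_left h, dual_chart_right h]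
    exact hw
  · intro hx
    refine ⟨!₂[dual (y - z) (a - z) (x - z), dual (a - z) (y - z) (x - z)], by
      simpa [-map_sub, refTri] using hx, ?_⟩
    have := dual_expand h (x - z)
    simp only [chart]
    simp only [Matrix.cons_val_zero, Matrix.cons_val_one]
    rw [← this]; abel

/-- The Jacobian `c` is the same for all `f`, so `f = 1` ties it to the area; this makes the inverse
inequality scale invariant. -/
lemma integral_hull {z y a : Plane} (h : cross (y - z) (a - z) ≠ 0) :
    ∃ c : ℝ, 0 ≤ c ∧ ∀ f : Plane → ℝ, ∫ x in convexHull ℝ (tri z y a : Set Plane), f x =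
      c * ∫ x in refTri, f (chart z y a x) := by
  set L : Plane →L[ℝ] Plane :=
    (EuclideanSpace.proj (0 : Fin 2) : Plane →L[ℝ] ℝ).smulRight (y - z) +
      (EuclideanSpace.proj (1 : Fin 2) : Plane →L[ℝ] ℝ).smulRight (a - z) with hL
  have hd : ∀ x, HasFDerivAt (chart z y a) L x := by
    intro x
    have : chart z y a = fun x => z + L x := by ext1 w; simp [chart, hL]
    rw [this]
    exact L.hasFDerivAt.const_add z
  have hinj : Set.InjOn (chart z y a) refTri := by
    intro u _ w _ huw
    apply plane_ext
    · rw [← dual_chart_left h, huw, dual_chart_left h]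
    · rw [← dual_chart_right h, huw, dual_chart_right h]
  refine ⟨|L.det|, abs_nonneg _, fun f => ?_⟩
  rw [← chart_image h, integral_image_eq_integral_abs_det_fderiv_smul volume
    isCompact_refTri.measurableSet (fun x _ => (hd x).hasFDerivWithinAt) hinj]
  simp only [smul_eq_mul]
  rw [integral_const_mul]

lemma integral_refTri {f : ℝ → ℝ → ℝ} (hf : Continuous fun p : ℝ × ℝ => f p.1 p.2) :
    ∫ x in refTri, f (x 0) (x 1) = ∫ s in (0 : ℝ)..1, ∫ t in (0 : ℝ)..(1 - s), f s t := by
  set R : Set (ℝ × ℝ) := {p | 0 ≤ p.1 ∧ 0 ≤ p.2 ∧ p.1 + p.2 ≤ 1} with hR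
  have hRc : IsCompact R := by
    have hcl : IsClosed R := (isClosed_le continuous_const continuous_fst).inter
      ((isClosed_le continuous_const continuous_snd).inter
      (isClosed_le (continuous_fst.add continuous_snd) continuous_const))
    refine IsCompact.of_isClosed_subset (isCompact_Icc (a := ((0 : ℝ), (0 : ℝ))) (b := (1, 1)))
      hcl ?_
    rintro ⟨p, q⟩ ⟨h0, h1, h2⟩
    simp only at h0 h1 h2
    exact ⟨⟨h0, h1⟩, ⟨by simp; linarith, by simp; linarith⟩⟩
  let φ : Plane ≃ᵐ ℝ × ℝ :=
    (MeasurableEquiv.toLp 2 (Fin 2 → ℝ)).symm.trans MeasurableEquiv.finTwoArrow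
  have hφ : MeasurePreserving φ volume volume :=
    (EuclideanSpace.volume_preserving_symm_measurableEquiv_toLp (Fin 2)).trans
      (volume_preserving_finTwoArrow ℝ)
  have h1 : ∫ x in refTri, f (x 0) (x 1) = ∫ p in R, f p.1 p.2 := by
    have := hφ.setIntegral_preimage_emb φ.measurableEmbedding (fun p => f p.1 p.2) R
    rw [← this]; rfl
  have hint : Integrable (R.indicator fun p : ℝ × ℝ => f p.1 p.2) (volume.prod volume) := by
    rw [integrable_indicator_iff hRc.measurableSet]
    exact hf.continuousOn.integrableOn_compact hRc
  rw [h1, ← integral_indicator hRc.measurableSet, Measure.volume_eq_prod,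
    integral_prod _ hint, intervalIntegral.integral_of_le zero_le_one,
    ← integral_Icc_eq_integral_Ioc, ← integral_indicator measurableSet_Icc]
  congr 1
  ext s
  by_cases hs : s ∈ Set.Icc (0 : ℝ) 1
  · rw [Set.indicator_of_mem hs, intervalIntegral.integral_of_le (by linarith [hs.2]),
      ← integral_Icc_eq_integral_Ioc, ← integral_indicator measurableSet_Icc]
    congr 1
    ext t
    have : (s, t) ∈ R ↔ t ∈ Set.Icc 0 (1 - s) := by
      simp only [hR, Set.mem_ofPred_eq, Set.mem_Icc]
      exact ⟨fun h => ⟨h.2.1, by linarith [h.2.2]⟩, fun h => ⟨hs.1, h.1, by linarith [h.2]⟩⟩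
    by_cases ht : t ∈ Set.Icc 0 (1 - s)
    · rw [Set.indicator_of_mem (this.2 ht), Set.indicator_of_mem ht]
    · rw [Set.indicator_of_notMem (mt this.1 ht), Set.indicator_of_notMem ht]
  · rw [Set.indicator_of_notMem hs]
    have : ∀ t, R.indicator (fun p : ℝ × ℝ => f p.1 p.2) (s, t) = 0 := by
      intro t
      refine Set.indicator_of_notMem (fun h => hs ⟨h.1, ?_⟩) _
      have := h.2.1; have := h.2.2; simp only at *; linarith
    simp [this]

/-- The integrals over a triangle of the polynomials in barycentric coordinates that occur in the
divergence of the edge fields vanish. -/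
lemma integral_bary_eq_zero {z y a : Plane} (h : cross (y - z) (a - z) ≠ 0) (c₁ c₂ c₃ : ℝ) :
    ∫ x in convexHull ℝ (tri z y a : Set Plane),
      (fun s t : ℝ => c₁ * (s ^ 2 - 2 * s * t) + c₂ * (3 * s ^ 2 * t - 3 * s * t ^ 2) +
        c₃ * (s ^ 3 - 3 * s ^ 2 * t))
      (1 - dual (y - z) (a - z) (x - z) - dual (a - z) (y - z) (x - z))
      (dual (y - z) (a - z) (x - z)) = 0 := by
  obtain ⟨c, -, hc⟩ := integral_hull h
  rw [hc]
  simp only [dual_chart_left h, dual_chart_right h]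
  -- The chart coordinates are the weights `t` of `y` and `r` of `a`, so that `s = 1 - t - r`.
  rw [integral_refTri (f := fun t r => (fun s t : ℝ => c₁ * (s ^ 2 - 2 * s * t) +
    c₂ * (3 * s ^ 2 * t - 3 * s * t ^ 2) + c₃ * (s ^ 3 - 3 * s ^ 2 * t)) (1 - t - r) t)
    (by simp only; fun_prop)]
  have hin : ∀ t : ℝ, (∫ r in (0 : ℝ)..(1 - t), (c₁ * ((1 - t - r) ^ 2 - 2 * (1 - t - r) * t) +
    c₂ * (3 * (1 - t - r) ^ 2 * t - 3 * (1 - t - r) * t ^ 2) +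
    c₃ * ((1 - t - r) ^ 3 - 3 * (1 - t - r) ^ 2 * t))) =
    c₁ * ((1 - t) ^ 3 / 3 - t * (1 - t) ^ 2) +
      c₂ * (t * (1 - t) ^ 3 - 3 / 2 * t ^ 2 * (1 - t) ^ 2) +
      c₃ * ((1 - t) ^ 4 / 4 - t * (1 - t) ^ 3) := by
    intro t
    have hF : ∀ r ∈ Set.uIcc 0 (1 - t), HasDerivAt (fun r : ℝ =>
      -(c₁ * ((1 - t - r) ^ 3 / 3 - t * (1 - t - r) ^ 2) +
      c₂ * (t * (1 - t - r) ^ 3 - 3 / 2 * t ^ 2 * (1 - t - r) ^ 2) +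
      c₃ * ((1 - t - r) ^ 4 / 4 - t * (1 - t - r) ^ 3))) (c₁ * ((1 - t - r) ^ 2 -
      2 * (1 - t - r) * t) + c₂ * (3 * (1 - t - r) ^ 2 * t - 3 * (1 - t - r) * t ^ 2) +
      c₃ * ((1 - t - r) ^ 3 - 3 * (1 - t - r) ^ 2 * t)) r := by
      intro r _
      have h0 : HasDerivAt (fun r : ℝ => 1 - t - r) (-1) r := by
        simpa using (hasDerivAt_id r).const_sub (1 - t)
      have := ((((((h0.pow 3).div_const 3).sub ((h0.pow 2).const_mul t)).const_mul c₁).add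
        ((((h0.pow 3).const_mul t).sub ((h0.pow 2).const_mul (3 / 2 * t ^ 2))).const_mul c₂)).add
        ((((h0.pow 4).div_const 4).sub ((h0.pow 3).const_mul t)).const_mul c₃)).neg
      refine this.congr_deriv ?_
      push_cast; ring
    rw [intervalIntegral.integral_eq_sub_of_hasDerivAt hF
      (Continuous.intervalIntegrable (by fun_prop) _ _)]
    ring
  simp only [hin]
  -- The part of this primitive belonging to each of `c₁`, `c₂`, `c₃` takes equal values at 0 and 1.
  have hG : ∀ t ∈ Set.uIcc (0 : ℝ) 1, HasDerivAt (fun t : ℝ =>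
      c₁ * (-(1 - t) ^ 3 * (1 - t) / 12 - (t ^ 2 / 2 - 2 / 3 * t ^ 3 + t ^ 4 / 4)) +
      c₂ * (t ^ 2 / 2 - t ^ 3 + 3 / 4 * t ^ 4 - t ^ 5 / 5 -
        3 / 2 * (t ^ 3 / 3 - t ^ 4 / 2 + t ^ 5 / 5)) +
      c₃ * (-(1 - t) ^ 5 / 20 - (t ^ 2 / 2 - t ^ 3 + 3 / 4 * t ^ 4 - t ^ 5 / 5)))
      (c₁ * ((1 - t) ^ 3 / 3 - t * (1 - t) ^ 2) +
      c₂ * (t * (1 - t) ^ 3 - 3 / 2 * t ^ 2 * (1 - t) ^ 2) +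
      c₃ * ((1 - t) ^ 4 / 4 - t * (1 - t) ^ 3)) t := by
    intro t _
    have h0 : HasDerivAt (fun r : ℝ => 1 - r) (-1) t := by
      simpa using (hasDerivAt_id t).const_sub 1
    have hp : ∀ n : ℕ, HasDerivAt (fun r : ℝ => r ^ n) (n * t ^ (n - 1)) t :=
      fun n => hasDerivAt_pow n t
    have hq := ((((hp 2).div_const 2).sub (hp 3)).add ((hp 4).const_mul (3 / 4))).sub
      ((hp 5).div_const 5)
    have := ((((((h0.pow 3).neg.mul h0).div_const 12).sub
      ((((hp 2).div_const 2).sub ((hp 3).const_mul (2 / 3))).add ((hp 4).div_const 4))).const_mul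
        c₁).add ((hq.sub (((((hp 3).div_const 3).sub ((hp 4).div_const 2)).add
        ((hp 5).div_const 5)).const_mul (3 / 2))).const_mul c₂)).add
        ((((h0.pow 5).neg.div_const 20).sub hq).const_mul c₃)
    refine this.congr_deriv ?_
    simp only [Pi.pow_apply, Pi.neg_apply]
    push_cast; ring
  rw [intervalIntegral.integral_eq_sub_of_hasDerivAt hG
    (Continuous.intervalIntegrable (by fun_prop) _ _)]
  ring

/-! ### An inverse inequality -/

lemma isPolyOn_comp_chart (z y a : Plane) {m : ℕ} {P : MvPolynomial (Fin 2) ℝ}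
    (hP : P.totalDegree ≤ m) :
    IsPolyOn Set.univ m (fun x => MvPolynomial.eval (fun i => chart z y a x i) P) := by
  have hc : ∀ i, IsPolyOn Set.univ 1 (fun x => chart z y a x i) := by
    intro i
    refine ((IsPolyOn.const (z i)).add (((IsPolyOn.coord 0).const_mul ((y - z) i)).add
      ((IsPolyOn.coord 1).const_mul ((a - z) i)))).congr fun x _ => ?_
    simp [chart]; ring
  simp only [MvPolynomial.eval_eq', Fin.prod_univ_two]
  refine IsPolyOn.sum _ fun d hd => ?_
  refine ((((hc 0).pow (d 0)).mul ((hc 1).pow (d 1))).const_mul _).mono ?_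
  have := (MvPolynomial.le_totalDegree hd).trans hP
  rw [Finsupp.sum_fintype _ _ (by simp), Fin.sum_univ_two] at this
  simpa using this

lemma continuous_eval (P : MvPolynomial (Fin 2) ℝ) :
    Continuous fun x : Plane => MvPolynomial.eval (fun i => x i) P :=
  (MvPolynomial.continuous_eval P).comp (by fun_prop)

/-- Evaluation at the corner 0 factors through the image of the polynomials in `L²`: one that
vanishes almost everywhere on the triangle vanishes on its interior, and by continuity at the
corner. The image has finite dimension, so the induced functional is bounded. -/
lemma exists_eval_zero_sq_le (m : ℕ) : ∃ C : ℝ, 0 < C ∧ ∀ P : MvPolynomial (Fin 2) ℝ,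
    P.totalDegree ≤ m → MvPolynomial.eval (fun _ => 0) P ^ 2 ≤
      C * ∫ x in refTri, MvPolynomial.eval (fun i => x i) P ^ 2 := by
  set μ : Measure Plane := volume.restrict refTri with hμ
  have : IsFiniteMeasure μ := ⟨by
    rw [hμ, Measure.restrict_apply_univ]; exact isCompact_refTri.measure_lt_top⟩
  let V := MvPolynomial.restrictTotalDegree (Fin 2) ℝ m
  have hmem : ∀ P : MvPolynomial (Fin 2) ℝ,
      MemLp (fun x : Plane => MvPolynomial.eval (fun i => x i) P) 2 μ := by
    intro P
    obtain ⟨B, hB⟩ := isCompact_refTri.exists_bound_of_continuousOn (continuous_eval P).continuousOn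
    refine MemLp.of_bound (continuous_eval P).aestronglyMeasurable B ?_
    rw [hμ, ae_restrict_iff' isCompact_refTri.measurableSet]
    exact Filter.Eventually.of_forall hB
  let L : V →ₗ[ℝ] Lp ℝ 2 μ :=
    { toFun := fun P => (hmem P.1).toLp _
      map_add' := by
        intro P Q
        rw [← MemLp.toLp_add]
        congr 1; ext x; simp
      map_smul' := by
        intro c P
        simp only [RingHom.id_apply]
        rw [← MemLp.toLp_const_smul]
        congr 1; ext x; simp }
  let φ : V →ₗ[ℝ] ℝ :=
    { toFun := fun P => MvPolynomial.eval (fun _ => 0) P.1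
      map_add' := by simp
      map_smul' := by simp }
  have hker : LinearMap.ker L ≤ LinearMap.ker φ := by
    intro P hP
    have h0 : (fun x : Plane => MvPolynomial.eval (fun i => x i) P.1) =ᵐ[μ] 0 := by
      have h1 : (hmem P.1).toLp _ = 0 := hP
      have h2 := (hmem P.1).coeFn_toLp
      rw [h1] at h2
      exact h2.symm.trans (Lp.coeFn_zero _ _ _)
    set O : Set Plane := {x | 0 < x 0 ∧ 0 < x 1 ∧ x 0 + x 1 < 1} with hO
    have hOo : IsOpen O := by
      have h0 : Continuous fun x : Plane => x 0 := by fun_prop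
      have h1 : Continuous fun x : Plane => x 1 := by fun_prop
      exact (isOpen_lt continuous_const h0).inter ((isOpen_lt continuous_const h1).inter
        (isOpen_lt (h0.add h1) continuous_const))
    have hOs : O ⊆ refTri := fun x hx => ⟨hx.1.le, hx.2.1.le, hx.2.2.le⟩
    have h3 : (fun x : Plane => MvPolynomial.eval (fun i => x i) P.1) =ᵐ[volume.restrict O]
        fun _ => 0 := ae_restrict_of_ae_restrict_of_subset hOs h0
    have h4 := Measure.eqOn_open_of_ae_eq h3 hOo (continuous_eval P.1).continuousOn
      continuousOn_const
    have h5 := h4.closure (continuous_eval P.1) continuous_const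
    have h6 : (0 : Plane) ∈ closure O := by
      have hcont : Filter.Tendsto (fun ε : ℝ => (!₂[ε, ε] : Plane)) (𝓝[>] 0) (𝓝 0) := by
        have : ContinuousAt (fun ε : ℝ => (!₂[ε, ε] : Plane)) 0 := by fun_prop
        have h0 : (!₂[0, 0] : Plane) = 0 := by apply plane_ext <;> simp
        have h1 := this.tendsto
        rw [h0] at h1
        exact h1.mono_left nhdsWithin_le_nhds
      refine mem_closure_of_tendsto hcont ?_
      have : ∀ᶠ ε : ℝ in 𝓝[>] 0, ε < 1 / 2 :=
        nhdsWithin_le_nhds (gt_mem_nhds (by norm_num))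
      filter_upwards [this, self_mem_nhdsWithin] with ε h1 h2
      have h2 : 0 < ε := h2
      simp only [hO, Set.mem_ofPred_eq, Matrix.cons_val_zero, Matrix.cons_val_one]
      exact ⟨h2, h2, by linarith⟩
    simpa [φ] using h5 h6
  let ψ : LinearMap.range L →ₗ[ℝ] ℝ :=
    ((LinearMap.ker L).liftQ φ hker).comp L.quotKerEquivRange.symm.toLinearMap
  let Ψ := LinearMap.toContinuousLinearMap ψ
  refine ⟨‖Ψ‖ ^ 2 + 1, by positivity, fun P hP => ?_⟩
  let p : V := ⟨P, (MvPolynomial.mem_restrictTotalDegree _ _ _).2 hP⟩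
  have h1 : Ψ ⟨L p, LinearMap.mem_range_self L p⟩ = MvPolynomial.eval (fun _ => 0) P := by
    have : L.quotKerEquivRange.symm ⟨L p, LinearMap.mem_range_self L p⟩ =
        (LinearMap.ker L).mkQ p := L.quotKerEquivRange_symm_apply_image p _
    simp only [Ψ, ψ, LinearMap.coe_toContinuousLinearMap', LinearMap.comp_apply,
      LinearEquiv.coe_coe, this]
    simp [φ, p]
  have h2 : ‖L p‖ ^ 2 = ∫ x in refTri, MvPolynomial.eval (fun i => x i) P ^ 2 := by
    rw [← real_inner_self_eq_norm_sq, L2.inner_def]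
    refine integral_congr_ae ?_
    filter_upwards [(hmem P).coeFn_toLp] with x hx
    change inner ℝ ((hmem P).toLp _ x) ((hmem P).toLp _ x) = _
    rw [hx]; simp [pow_two]
  have h3 := Ψ.le_opNorm ⟨L p, LinearMap.mem_range_self L p⟩
  rw [h1] at h3
  have h4 : ‖(⟨L p, LinearMap.mem_range_self L p⟩ : LinearMap.range L)‖ = ‖L p‖ := rfl
  rw [h4] at h3
  have h5 := pow_le_pow_left₀ (norm_nonneg _) h3 2
  rw [mul_pow, h2, Real.norm_eq_abs, sq_abs] at h5
  have : 0 ≤ ∫ x in refTri, MvPolynomial.eval (fun i => x i) P ^ 2 :=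
    integral_nonneg fun x => sq_nonneg _
  nlinarith

lemma exists_inverse_inequality (m : ℕ) : ∃ C : ℝ, 0 < C ∧ ∀ z y a : Plane,
    cross (y - z) (a - z) ≠ 0 → ∀ P : MvPolynomial (Fin 2) ℝ, P.totalDegree ≤ m →
      volume.real (convexHull ℝ (tri z y a : Set Plane)) * MvPolynomial.eval (fun i => z i) P ^ 2 ≤
        C * ∫ x in convexHull ℝ (tri z y a : Set Plane), MvPolynomial.eval (fun i => x i) P ^ 2 := by
  obtain ⟨C, hC, hC'⟩ := exists_eval_zero_sq_le m
  refine ⟨volume.real refTri * C + 1, by positivity, fun z y a h P hP => ?_⟩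
  obtain ⟨c, hc0, hc⟩ := integral_hull h
  obtain ⟨Q, hQ, hQe⟩ := isPolyOn_comp_chart z y a hP
  have hv : volume.real (convexHull ℝ (tri z y a : Set Plane)) = c * volume.real refTri := by
    have := hc fun _ => 1
    simpa using this
  have h1 := hC' Q hQ
  have h0 : MvPolynomial.eval (fun _ => 0) Q = MvPolynomial.eval (fun i => z i) P := by
    have := hQe 0 trivial
    simpa [chart] using this.symm
  rw [h0] at h1
  simp only [← hQe _ (Set.mem_univ _)] at h1
  rw [hc, hv]
  have hn : 0 ≤ c * ∫ x in refTri, MvPolynomial.eval (fun i => chart z y a x i) P ^ 2 :=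
    mul_nonneg hc0 (integral_nonneg fun x => sq_nonneg _)
  calc _ = (c * volume.real refTri) * MvPolynomial.eval (fun i => z i) P ^ 2 := by ring
    _ ≤ (c * volume.real refTri) *
      (C * ∫ x in refTri, MvPolynomial.eval (fun i => chart z y a x i) P ^ 2) := by gcongr
    _ ≤ _ := by nlinarith

/-! ### Correctors on a single triangle -/

/-- The properties on the triangle `T` of a piecewise polynomial field `v` of degree `k` whose
divergence has the value `δ` at the vertex `z`, vanishes at the other vertices, and has mean zero.
Its gradient is bounded by `B`. -/
structure LocalCorrector (T : Finset Plane) (z : Plane) (k : ℕ) (B δ : ℝ) (v : Plane → Plane) :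
    Prop where
  poly : ∀ i, IsPolyOn (convexHull ℝ (T : Set Plane)) k (fun x => v x i)
  diff : ∀ x ∈ interior (convexHull ℝ (T : Set Plane)), DifferentiableAt ℝ v x
  bound : ∀ x ∈ interior (convexHull ℝ (T : Set Plane)), ‖fderiv ℝ v x‖ ≤ B
  tendsto_vertex : z ∈ T → Filter.Tendsto (divergence v)
    (𝓝[interior (convexHull ℝ (T : Set Plane))] z) (𝓝 δ)
  tendsto_other : ∀ σ ∈ T, σ ≠ z → Filter.Tendsto (divergence v)
    (𝓝[interior (convexHull ℝ (T : Set Plane))] σ) (𝓝 0)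
  integrable : IntegrableOn (divergence v) (convexHull ℝ (T : Set Plane))
  integral : ∫ x in convexHull ℝ (T : Set Plane), divergence v x = 0

/-- The boundary of a convex set is null. Integrals therefore ignore the edges, where the fields
need not be differentiable and `fderiv` may be a default value. -/
lemma ae_mem_interior_hull (T : Finset Plane) :
    ∀ᵐ x ∂volume.restrict (convexHull ℝ (T : Set Plane)),
      x ∈ interior (convexHull ℝ (T : Set Plane)) := by
  have hcl := Triangulation.isClosed_hull T
  have h0 := (convex_convexHull ℝ (T : Set Plane)).addHaar_frontier (μ := volume)
  rw [ae_restrict_iff' hcl.measurableSet]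
  filter_upwards [measure_eq_zero_iff_ae_notMem.1 h0] with x hx hxT
  by_contra hcon
  exact hx (by rw [frontier, hcl.closure_eq]; exact ⟨hxT, hcon⟩)

lemma divergence_congr {v w : Plane → Plane} {x : Plane} (h : v =ᶠ[𝓝 x] w) :
    divergence v x = divergence w x := by
  simp only [divergence, partialDeriv, h.fderiv_eq]

lemma divergence_add {v w : Plane → Plane} {x : Plane} (hv : DifferentiableAt ℝ v x)
    (hw : DifferentiableAt ℝ w x) :
    divergence (fun x => v x + w x) x = divergence v x + divergence w x := by
  simp only [divergence, partialDeriv]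
  rw [fderiv_fun_add hv hw]
  simp [Finset.sum_add_distrib]

lemma divergence_smul {v : Plane → Plane} {x : Plane} (hv : DifferentiableAt ℝ v x) (c : ℝ) :
    divergence (fun x => c • v x) x = c * divergence v x := by
  simp only [divergence, partialDeriv]
  rw [fderiv_fun_const_smul hv]
  simp [mul_add]

namespace LocalCorrector
variable {T : Finset Plane} {z : Plane} {k l : ℕ} {B B' δ δ' : ℝ} {v w : Plane → Plane}

lemma mono (h : LocalCorrector T z k B δ v) (hB : B ≤ B') (hk : k ≤ l) :
    LocalCorrector T z l B' δ v :=
  { h with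
    poly := fun i => (h.poly i).mono hk
    bound := fun x hx => (h.bound x hx).trans hB }

lemma congr (h : LocalCorrector T z k B δ v)
    (hvw : ∀ x ∈ convexHull ℝ (T : Set Plane), w x = v x) : LocalCorrector T z k B δ w := by
  have hev : ∀ x ∈ interior (convexHull ℝ (T : Set Plane)), w =ᶠ[𝓝 x] v := by
    intro x hx
    filter_upwards [isOpen_interior.mem_nhds hx] with y hy using hvw y (interior_subset hy)
  have hd : ∀ x ∈ interior (convexHull ℝ (T : Set Plane)), divergence v x = divergence w x :=
    fun x hx => divergence_congr (hev x hx).symm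
  have hae : divergence v =ᵐ[volume.restrict (convexHull ℝ (T : Set Plane))] divergence w := by
    filter_upwards [ae_mem_interior_hull T] with x hx using hd x hx
  exact
    { poly := fun i => (h.poly i).congr fun x hx => by rw [hvw x hx]
      diff := fun x hx => (hev x hx).differentiableAt_iff.2 (h.diff x hx)
      bound := fun x hx => by rw [(hev x hx).fderiv_eq]; exact h.bound x hx
      tendsto_vertex := fun hz => (h.tendsto_vertex hz).congr'
        (eventually_nhdsWithin_of_forall hd)
      tendsto_other := fun σ hσ hne => (h.tendsto_other σ hσ hne).congr'
        (eventually_nhdsWithin_of_forall hd)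
      integrable := h.integrable.congr hae
      integral := by rw [← integral_congr_ae hae, h.integral] }

lemma zero (T : Finset Plane) (z : Plane) (k : ℕ) (hB : 0 ≤ B) :
    LocalCorrector T z k B 0 (fun _ => 0) := by
  have hd : divergence (fun _ => 0) = fun _ => 0 := by
    ext x; simp [divergence, partialDeriv]
  refine ⟨fun i => ?_, fun x _ => differentiableAt_const _, fun x _ => by simpa using hB,
    fun _ => ?_, fun σ _ _ => ?_, ?_, ?_⟩
  · simpa using (IsPolyOn.const 0).mono (Nat.zero_le k)
  all_goals rw [hd]
  · exact tendsto_const_nhds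
  · exact tendsto_const_nhds
  · exact integrableOn_zero
  · simp

lemma add (hv : LocalCorrector T z k B δ v) (hw : LocalCorrector T z k B' δ' w) :
    LocalCorrector T z k (B + B') (δ + δ') (fun x => v x + w x) := by
  have hd : ∀ x ∈ interior (convexHull ℝ (T : Set Plane)),
      divergence v x + divergence w x = divergence (fun x => v x + w x) x :=
    fun x hx => (divergence_add (hv.diff x hx) (hw.diff x hx)).symm
  have hae : (fun x => divergence v x + divergence w x)
      =ᵐ[volume.restrict (convexHull ℝ (T : Set Plane))] divergence (fun x => v x + w x) := by
    filter_upwards [ae_mem_interior_hull T] with x hx using hd x hx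
  exact
    { poly := fun i => by simpa using (hv.poly i).add (hw.poly i)
      diff := fun x hx => (hv.diff x hx).add (hw.diff x hx)
      bound := fun x hx => by
        rw [fderiv_fun_add (hv.diff x hx) (hw.diff x hx)]
        exact (norm_add_le _ _).trans (add_le_add (hv.bound x hx) (hw.bound x hx))
      tendsto_vertex := fun hz => ((hv.tendsto_vertex hz).add (hw.tendsto_vertex hz)).congr'
        (eventually_nhdsWithin_of_forall hd)
      tendsto_other := fun σ hσ hne => by
        have := (hv.tendsto_other σ hσ hne).add (hw.tendsto_other σ hσ hne)
        rw [add_zero] at this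
        exact this.congr' (eventually_nhdsWithin_of_forall hd)
      integrable := (hv.integrable.add hw.integrable).congr hae
      integral := by
        rw [← integral_congr_ae hae, integral_add hv.integrable hw.integrable, hv.integral,
          hw.integral, add_zero] }

lemma smul (hv : LocalCorrector T z k B δ v) (c : ℝ) :
    LocalCorrector T z k (|c| * B) (c * δ) (fun x => c • v x) := by
  have hd : ∀ x ∈ interior (convexHull ℝ (T : Set Plane)),
      c * divergence v x = divergence (fun x => c • v x) x :=
    fun x hx => (divergence_smul (hv.diff x hx) c).symm
  have hae : (fun x => c * divergence v x)
      =ᵐ[volume.restrict (convexHull ℝ (T : Set Plane))] divergence (fun x => c • v x) := by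
    filter_upwards [ae_mem_interior_hull T] with x hx using hd x hx
  exact
    { poly := fun i => by simpa using (hv.poly i).const_mul c
      diff := fun x hx => (hv.diff x hx).const_smul c
      bound := fun x hx => by
        rw [fderiv_fun_const_smul (hv.diff x hx), norm_smul, Real.norm_eq_abs]
        exact mul_le_mul_of_nonneg_left (hv.bound x hx) (abs_nonneg c)
      tendsto_vertex := fun hz => ((hv.tendsto_vertex hz).const_mul c).congr'
        (eventually_nhdsWithin_of_forall hd)
      tendsto_other := fun σ hσ hne => by
        have := (hv.tendsto_other σ hσ hne).const_mul c
        rw [mul_zero] at this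
        exact this.congr' (eventually_nhdsWithin_of_forall hd)
      integrable := (Integrable.const_mul hv.integrable c).congr hae
      integral := by
        rw [← integral_congr_ae hae, integral_const_mul, hv.integral, mul_zero] }

end LocalCorrector

/-! ### The field of an edge, on one triangle -/

/-- The field `s² t (μ e + γ (s - 3/2 t) e^⊥)`, where `s = 1 + S (x - z)` and `t = T (x - z)`. -/
def polyField (S T : Plane →L[ℝ] ℝ) (z e : Plane) (μ γ : ℝ) (x : Plane) : Plane :=
  ((1 + S (x - z)) ^ 2 * T (x - z)) •
    (μ • e + (γ * ((1 + S (x - z)) - 3 / 2 * T (x - z))) • rot e)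

lemma hasFDerivAt_polyField (S T : Plane →L[ℝ] ℝ) (z e : Plane) (μ γ : ℝ) (x : Plane) :
    HasFDerivAt (polyField S T z e μ γ)
      (((2 * (1 + S (x - z)) * T (x - z)) • S + (1 + S (x - z)) ^ 2 • T).smulRight
          (μ • e + (γ * ((1 + S (x - z)) - 3 / 2 * T (x - z))) • rot e) +
        (((1 + S (x - z)) ^ 2 * T (x - z)) • (γ • (S - (3 / 2 : ℝ) • T))).smulRight (rot e)) x := by
  have hs : HasFDerivAt (fun x => 1 + S (x - z)) S x := by
    simp only [map_sub]
    exact (S.hasFDerivAt.sub_const (S z)).const_add 1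
  have ht : HasFDerivAt (fun x => T (x - z)) T x := by
    simp only [map_sub]
    exact T.hasFDerivAt.sub_const (T z)
  have h1 := (hs.pow 2).mul ht
  have h2 := ((((hs.sub (ht.const_mul (3 / 2))).const_mul γ).smul_const (rot e)).const_add (μ • e))
  have h3 := h1.smul h2
  refine h3.congr_fderiv ?_
  ext h i
  simp only [Pi.sub_apply, add_apply,
    smul_apply, ContinuousLinearMap.smulRight_apply,
    sub_apply, PiLp.add_apply, PiLp.smul_apply, smul_eq_mul, Pi.mul_apply,
    nsmul_eq_mul]
  push_cast
  ring

lemma divergence_of_hasFDerivAt {v : Plane → Plane} {x w₁ w₂ : Plane} {L₁ L₂ : Plane →L[ℝ] ℝ}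
    (h : HasFDerivAt v (L₁.smulRight w₁ + L₂.smulRight w₂) x) :
    divergence v x = L₁ w₁ + L₂ w₂ := by
  have hw : ∀ w : Plane, w = w 0 • EuclideanSpace.single 0 1 + w 1 • EuclideanSpace.single 1 1 := by
    intro w; apply plane_ext <;> simp
  simp only [divergence, partialDeriv, h.fderiv, Fin.sum_univ_two]
  conv_rhs => rw [hw w₁, hw w₂]
  simp only [add_apply, ContinuousLinearMap.smulRight_apply, PiLp.add_apply,
    PiLp.smul_apply, smul_eq_mul, map_add, map_smul]
  ring

/-- Every term has a factor `s`, so the divergence vanishes on the edge opposite `z`; at `z`, where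
`s = 1` and `t = 0`, it is `μ + γ * T (rot e)`. The coefficient `3/2` is the one for which both
cubic terms have mean zero. -/
lemma divergence_polyField {S T : Plane →L[ℝ] ℝ} {e : Plane} (hS : S e = -1) (hT : T e = 1)
    (z : Plane) (μ γ : ℝ) (x : Plane) :
    divergence (polyField S T z e μ γ) x =
      (fun s t : ℝ => μ * (s ^ 2 - 2 * s * t) +
        (γ * S (rot e)) * (3 * s ^ 2 * t - 3 * s * t ^ 2) +
        (γ * T (rot e)) * (s ^ 3 - 3 * s ^ 2 * t)) (1 + S (x - z)) (T (x - z)) := by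
  rw [divergence_of_hasFDerivAt (hasFDerivAt_polyField S T z e μ γ x)]
  simp only [add_apply, smul_apply,
    sub_apply, map_add, map_smul, smul_eq_mul, hS, hT]
  ring

lemma isPolyOn_polyField (S T : Plane →L[ℝ] ℝ) (z e : Plane) {μ γ : ℝ} {k : ℕ}
    (hk : 4 ≤ k ∨ γ = 0 ∧ 3 ≤ k) (A : Set Plane) (i : Fin 2) :
    IsPolyOn A k (fun x => polyField S T z e μ γ x i) := by
  have hs : IsPolyOn A 1 (fun x => 1 + S (x - z)) :=
    ((IsPolyOn.const 1).mono (Nat.zero_le 1)).add (IsPolyOn.linear S z)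
  have ht : IsPolyOn A 1 (fun x => T (x - z)) := IsPolyOn.linear T z
  have hst := (hs.pow 2).mul ht
  rcases hk with hk | ⟨rfl, hk⟩
  · refine ((hst.mul (((IsPolyOn.const (μ * e i)).mono (Nat.zero_le 1)).add
      ((hs.add (ht.const_mul (-(3 / 2)))).const_mul (γ * rot e i)))).mono hk).congr
        fun x _ => ?_
    simp only [polyField, PiLp.add_apply, PiLp.smul_apply, smul_eq_mul]; ring
  · refine ((hst.const_mul (μ * e i)).mono hk).congr fun x _ => ?_
    simp only [polyField, PiLp.add_apply, PiLp.smul_apply, smul_eq_mul]; ring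

/-- Since `s` and `t` lie in `[0, 1]`, only the scale-invariant products of gradient and edge length
enter, and the bound does not see the mesh size. -/
lemma norm_fderiv_polyField_le {S T : Plane →L[ℝ] ℝ} {z e x : Plane} {μ γ R : ℝ}
    (hS : ‖S‖ * ‖e‖ ≤ R) (hT : ‖T‖ * ‖e‖ ≤ R) (hs : 0 ≤ 1 + S (x - z)) (ht : 0 ≤ T (x - z))
    (hst : 1 + S (x - z) + T (x - z) ≤ 1) :
    ‖fderiv ℝ (polyField S T z e μ γ) x‖ ≤ (3 * |μ| + 7 * |γ|) * R := by
  rw [(hasFDerivAt_polyField S T z e μ γ x).fderiv]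
  generalize 1 + S (x - z) = s at *
  generalize T (x - z) = t at *
  have hs1 : s ≤ 1 := by linarith
  have ht1 : t ≤ 1 := by linarith
  have hR : 0 ≤ R := (by positivity : 0 ≤ ‖S‖ * ‖e‖).trans hS
  have h1 : ‖(2 * s * t) • S + s ^ 2 • T‖ ≤ 2 * ‖S‖ + ‖T‖ := by
    refine (norm_add_le _ _).trans ?_
    rw [norm_smul, norm_smul, Real.norm_of_nonneg (by positivity),
      Real.norm_of_nonneg (by positivity)]
    have : s * t ≤ 1 := mul_le_one₀ hs1 ht ht1
    have h2 : s ^ 2 ≤ 1 := pow_le_one₀ hs hs1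
    nlinarith [norm_nonneg S, norm_nonneg T]
  have h2 : ‖μ • e + (γ * (s - 3 / 2 * t)) • rot e‖ ≤ (|μ| + 3 / 2 * |γ|) * ‖e‖ := by
    refine (norm_add_le _ _).trans ?_
    rw [norm_smul, norm_smul, norm_rot, Real.norm_eq_abs, Real.norm_eq_abs, abs_mul]
    have : |s - 3 / 2 * t| ≤ 3 / 2 := by rw [abs_le]; constructor <;> linarith
    nlinarith [mul_le_mul_of_nonneg_left this (mul_nonneg (abs_nonneg γ) (norm_nonneg e))]
  have h3 : ‖(s ^ 2 * t) • (γ • (S - (3 / 2 : ℝ) • T))‖ ≤ |γ| * (‖S‖ + 3 / 2 * ‖T‖) := by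
    rw [norm_smul, norm_smul, Real.norm_of_nonneg (by positivity), Real.norm_eq_abs]
    have h4 : ‖S - (3 / 2 : ℝ) • T‖ ≤ ‖S‖ + 3 / 2 * ‖T‖ := by
      refine (norm_sub_le _ _).trans ?_
      rw [norm_smul]; norm_num
    have h5 : s ^ 2 * t ≤ 1 := mul_le_one₀ (pow_le_one₀ hs hs1) ht ht1
    calc s ^ 2 * t * (|γ| * ‖S - (3 / 2 : ℝ) • T‖) ≤ 1 * (|γ| * (‖S‖ + 3 / 2 * ‖T‖)) := by
          gcongr
      _ = _ := one_mul _
  refine (norm_add_le _ _).trans ?_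
  rw [ContinuousLinearMap.norm_smulRight_apply, ContinuousLinearMap.norm_smulRight_apply, norm_rot]
  calc _ ≤ (2 * ‖S‖ + ‖T‖) * ((|μ| + 3 / 2 * |γ|) * ‖e‖) +
        |γ| * (‖S‖ + 3 / 2 * ‖T‖) * ‖e‖ := by gcongr
    _ = (2 * (‖S‖ * ‖e‖) + ‖T‖ * ‖e‖) * (|μ| + 3 / 2 * |γ|) +
        |γ| * (‖S‖ * ‖e‖ + 3 / 2 * (‖T‖ * ‖e‖)) := by ring
    _ ≤ (2 * R + R) * (|μ| + 3 / 2 * |γ|) + |γ| * (R + 3 / 2 * R) := by gcongr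
    _ = _ := by ring

/-- A functional that varies by at most one on a set is controlled by the size of an inscribed
disc. -/
lemma opNorm_mul_le_one {A : Set Plane} {c z : Plane} {r C : ℝ} {L : Plane →L[ℝ] ℝ} (hr0 : 0 < r)
    (hb : Metric.closedBall c r ⊆ A)
    (hL : ∀ x ∈ A, 0 ≤ C + L (x - z) ∧ C + L (x - z) ≤ 1) : ‖L‖ * (2 * r) ≤ 1 := by
  rw [← le_div_iff₀ (by positivity)]
  refine L.opNorm_le_bound (by positivity) fun h => ?_
  rcases eq_or_ne h 0 with rfl | hh
  · simp
  have hh' : 0 < ‖h‖ := norm_pos_iff.2 hh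
  have hn : ‖(r / ‖h‖) • h‖ = r := by
    rw [norm_smul, Real.norm_of_nonneg (by positivity)]; field_simp
  -- Antipodal points of the disc are `2 * r` apart, and `L` differs by at most one between them.
  have hp := hL (c + (r / ‖h‖) • h) (hb (by simp [hn]))
  have hm := hL (c - (r / ‖h‖) • h) (hb (by simp [hn]))
  simp only [map_sub, map_add, map_smul, smul_eq_mul] at hp hm
  have hab : |r / ‖h‖ * L h| ≤ 1 / 2 := by
    rw [abs_le]; constructor <;> linarith [hp.1, hp.2, hm.1, hm.2]
  rw [abs_mul, abs_of_pos (by positivity : 0 < r / ‖h‖)] at hab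
  rw [Real.norm_eq_abs]
  rw [div_mul_eq_mul_div, div_le_iff₀ hh'] at hab
  rw [div_mul_eq_mul_div, le_div_iff₀ (by positivity)]
  linarith

/-- Functionals that vary by at most one on a shape regular triangle have a controlled norm. -/
lemma opNorm_mul_le {T : Finset Plane} {c z e : Plane} {r ρ C : ℝ} {L : Plane →L[ℝ] ℝ} (hρ : 0 < ρ)
    (hb : Metric.closedBall c r ⊆ convexHull ℝ (T : Set Plane))
    (hr : ρ * Metric.diam (convexHull ℝ (T : Set Plane)) ≤ 2 * r)
    (he0 : e ≠ 0) (he : ‖e‖ ≤ Metric.diam (convexHull ℝ (T : Set Plane)))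
    (hL : ∀ x ∈ convexHull ℝ (T : Set Plane), 0 ≤ C + L (x - z) ∧ C + L (x - z) ≤ 1) :
    ‖L‖ * ‖e‖ ≤ 1 / ρ := by
  have he' : 0 < ‖e‖ := norm_pos_iff.2 he0
  have hr0 : 0 < r := by nlinarith
  rw [le_div_iff₀ hρ]
  calc ‖L‖ * ‖e‖ * ρ ≤ ‖L‖ * Metric.diam (convexHull ℝ (T : Set Plane)) * ρ := by gcongr
    _ = ‖L‖ * (ρ * Metric.diam (convexHull ℝ (T : Set Plane))) := by ring
    _ ≤ ‖L‖ * (2 * r) := by gcongr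
    _ ≤ 1 := opNorm_mul_le_one hr0 hb hL

lemma norm_sub_le_diam {T : Finset Plane} {x y : Plane} (hx : x ∈ T) (hy : y ∈ T) :
    ‖x - y‖ ≤ Metric.diam (convexHull ℝ (T : Set Plane)) := by
  rw [← dist_eq_norm]
  exact Metric.dist_le_diam_of_mem (Triangulation.isCompact_hull T).isBounded
    (subset_convexHull ℝ _ hx) (subset_convexHull ℝ _ hy)

/-- The rate of change of the hat function of `y` on the triangle `z y a`, in the direction of the
rotated edge `z y`. -/
def normalRate (z y a : Plane) : ℝ := dual (y - z) (a - z) (rot (y - z))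

/-- The polynomial field of the edge `z y` on the triangle `z y a`. -/
def sideField (z y a : Plane) (μ γ : ℝ) : Plane → Plane :=
  polyField (-(dual (y - z) (a - z) + dual (a - z) (y - z))) (dual (y - z) (a - z)) z (y - z) μ γ

lemma ne_zero_of_cross {u v : Plane} (h : cross u v ≠ 0) : u ≠ 0 := by
  rintro rfl
  simp [cross] at h

section
variable {z y a : Plane} {ρ : ℝ}

lemma norm_dual_mul_le (h : cross (y - z) (a - z) ≠ 0) (hρ : 0 < ρ)
    (hreg : ∃ (c : Plane) (r : ℝ), Metric.closedBall c r ⊆ convexHull ℝ (tri z y a : Set Plane) ∧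
      ρ * Metric.diam (convexHull ℝ (tri z y a : Set Plane)) ≤ 2 * r) :
    ‖dual (y - z) (a - z)‖ * ‖y - z‖ ≤ 1 / ρ ∧
      ‖-(dual (y - z) (a - z) + dual (a - z) (y - z))‖ * ‖y - z‖ ≤ 1 / ρ := by
  obtain ⟨c, r, hb, hr⟩ := hreg
  have hd : ‖y - z‖ ≤ Metric.diam (convexHull ℝ (tri z y a : Set Plane)) :=
    norm_sub_le_diam (by simp [tri]) (by simp [tri])
  constructor
  · refine opNorm_mul_le (C := 0) (z := z) hρ hb hr (ne_zero_of_cross h) hd fun x hx => ?_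
    obtain ⟨h1, h2, h3⟩ := (mem_hull_iff h x).1 hx
    constructor <;> linarith
  · refine opNorm_mul_le (C := 1) (z := z) hρ hb hr (ne_zero_of_cross h) hd fun x hx => ?_
    obtain ⟨h1, h2, h3⟩ := (mem_hull_iff h x).1 hx
    simp only [neg_apply, add_apply]
    constructor <;> linarith

lemma abs_normalRate_le (h : cross (y - z) (a - z) ≠ 0) (hρ : 0 < ρ)
    (hreg : ∃ (c : Plane) (r : ℝ), Metric.closedBall c r ⊆ convexHull ℝ (tri z y a : Set Plane) ∧
      ρ * Metric.diam (convexHull ℝ (tri z y a : Set Plane)) ≤ 2 * r) :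
    |normalRate z y a| ≤ 1 / ρ := by
  refine le_trans ?_ (norm_dual_mul_le h hρ hreg).1
  rw [← norm_rot (y - z)]
  exact (dual (y - z) (a - z)).le_opNorm (rot (y - z))

lemma localCorrector_sideField (h : cross (y - z) (a - z) ≠ 0) (hρ : 0 < ρ)
    (hreg : ∃ (c : Plane) (r : ℝ), Metric.closedBall c r ⊆ convexHull ℝ (tri z y a : Set Plane) ∧
      ρ * Metric.diam (convexHull ℝ (tri z y a : Set Plane)) ≤ 2 * r) {μ γ : ℝ} {k : ℕ}
    (hk : 4 ≤ k ∨ γ = 0 ∧ 3 ≤ k) :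
    LocalCorrector (tri z y a) z k ((3 * |μ| + 7 * |γ|) * (1 / ρ)) (μ + γ * normalRate z y a)
      (sideField z y a μ γ) := by
  have h' : cross (a - z) (y - z) ≠ 0 := by rw [cross_swap]; simpa using h
  obtain ⟨hT, hS⟩ := norm_dual_mul_le h hρ hreg
  have hTe : dual (y - z) (a - z) (y - z) = 1 := dual_left h
  have hSe : (-(dual (y - z) (a - z) + dual (a - z) (y - z))) (y - z) = -1 := by
    simp [-map_sub, dual_left h, dual_right]
  have hdiv := divergence_polyField hSe hTe z μ γ
  set S := -(dual (y - z) (a - z) + dual (a - z) (y - z)) with hSdef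
  set T := dual (y - z) (a - z) with hTdef
  have hcont : Continuous (divergence (polyField S T z (y - z) μ γ)) := by
    rw [funext hdiv]; fun_prop
  have hlim : ∀ σ A, Filter.Tendsto (divergence (polyField S T z (y - z) μ γ)) (𝓝[A] σ)
      (𝓝 (divergence (polyField S T z (y - z) μ γ) σ)) := fun σ A =>
    hcont.continuousAt.tendsto.mono_left nhdsWithin_le_nhds
  refine ⟨isPolyOn_polyField S T z _ hk _, fun x _ =>
    (hasFDerivAt_polyField S T z _ μ γ x).differentiableAt, fun x hx => ?_, fun _ => ?_,
    fun σ hσ hne => ?_, hcont.continuousOn.integrableOn_compact (Triangulation.isCompact_hull _),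
    ?_⟩
  · obtain ⟨h1, h2, h3⟩ := (mem_hull_iff h x).1 (interior_subset hx)
    refine norm_fderiv_polyField_le hS hT ?_ h1 ?_
    · simp only [neg_apply, add_apply]; linarith
    · simp only [neg_apply, add_apply]; linarith
  · have := hlim z (interior (convexHull ℝ (tri z y a : Set Plane)))
    have hv : divergence (polyField S T z (y - z) μ γ) z = μ + γ * normalRate z y a := by
      rw [hdiv]; simp [normalRate, ← hTdef]
    rwa [hv] at this
  · have := hlim σ (interior (convexHull ℝ (tri z y a : Set Plane)))
    have hv : divergence (polyField S T z (y - z) μ γ) σ = 0 := by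
      have hs0 : 1 + S (σ - z) = 0 := by
        simp only [tri, Finset.mem_insert, Finset.mem_singleton] at hσ
        rcases hσ with rfl | rfl | rfl
        · exact absurd rfl hne
        · rw [hSe]; ring
        · simp [-map_sub, hSdef, hTdef, dual_left h', dual_right]
      rw [hdiv, hs0]; simp
    rwa [hv] at this
  · have := integral_bary_eq_zero h μ (γ * S (rot (y - z))) (γ * T (rot (y - z)))
    rw [← this]
    refine integral_congr_ae (Filter.Eventually.of_forall fun x => ?_)
    have hs : 1 + S (x - z) = 1 - dual (y - z) (a - z) (x - z) - dual (a - z) (y - z) (x - z) := by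
      simp only [hSdef, neg_apply, add_apply, ← hTdef]; ring
    change divergence (polyField S T z (y - z) μ γ) x = _
    rw [hdiv, hs]

end

/-! ### Angles -/

lemma sin_angle_mul (u v : Plane) :
    Real.sin (InnerProductGeometry.angle u v) * (‖u‖ * ‖v‖) = |cross u v| := by
  rw [InnerProductGeometry.sin_angle_mul_norm_mul_norm, ← Real.sqrt_sq_eq_abs]
  congr 1
  simp only [inner_eq_dotp, dotp, cross]; ring

lemma cos_angle_mul (u v : Plane) :
    Real.cos (InnerProductGeometry.angle u v) * (‖u‖ * ‖v‖) = dotp u v := by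
  rw [InnerProductGeometry.cos_angle_mul_norm_mul_norm, inner_eq_dotp]

lemma sin_angle_pos {u v : Plane} (h : cross u v ≠ 0) :
    0 < Real.sin (InnerProductGeometry.angle u v) := by
  refine lt_of_le_of_ne (InnerProductGeometry.sin_angle_nonneg _ _) fun h0 => h ?_
  have := sin_angle_mul u v
  rw [← h0, zero_mul] at this
  exact abs_eq_zero.1 this.symm

lemma angle_pos_of_cross {u v : Plane} (h : cross u v ≠ 0) :
    0 < InnerProductGeometry.angle u v := by
  refine lt_of_le_of_ne (InnerProductGeometry.angle_nonneg _ _) fun h0 => ?_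
  have := sin_angle_pos h
  rw [← h0, Real.sin_zero] at this
  exact this.false

lemma angle_lt_pi_of_cross {u v : Plane} (h : cross u v ≠ 0) :
    InnerProductGeometry.angle u v < Real.pi := by
  refine lt_of_le_of_ne (InnerProductGeometry.angle_le_pi _ _) fun h0 => ?_
  have := sin_angle_pos h
  rw [h0, Real.sin_pi] at this
  exact this.false

/-- Up to the sign given by the orientation, this is the cotangent of the angle at `z`. -/
lemma normalRate_eq (z y a : Plane) :
    normalRate z y a = -(dotp (y - z) (a - z) / cross (y - z) (a - z)) := by
  rw [normalRate, dual_apply, ← neg_div]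
  congr 1
  simp only [cross, dotp, rot_zero, rot_one]; ring

/-- The jump of the normal derivative of a hat function across an edge is bounded below by the
sine of the sum of the adjacent angles. -/
lemma abs_sin_add_le {z y a b : Plane}
    (h : cross (y - z) (a - z) * cross (y - z) (b - z) < 0) :
    |Real.sin (EuclideanGeometry.angle a z y + EuclideanGeometry.angle y z b)| ≤
      |normalRate z y a - normalRate z y b| := by
  simp only [EuclideanGeometry.angle, vsub_eq_sub, normalRate_eq]
  rw [InnerProductGeometry.angle_comm (a - z) (y - z)]
  have sa := sin_angle_mul (y - z) (a - z)
  have sb := sin_angle_mul (y - z) (b - z)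
  have ca := cos_angle_mul (y - z) (a - z)
  have cb := cos_angle_mul (y - z) (b - z)
  have ha0 : cross (y - z) (a - z) ≠ 0 := fun h0 => by simp [h0] at h
  have hb0 : cross (y - z) (b - z) ≠ 0 := fun h0 => by simp [h0] at h
  have hsa := Real.sin_le_one (InnerProductGeometry.angle (y - z) (a - z))
  have hsb := Real.sin_le_one (InnerProductGeometry.angle (y - z) (b - z))
  rw [Real.sin_add]
  generalize cross (y - z) (a - z) = p at *
  generalize cross (y - z) (b - z) = q at *
  generalize dotp (y - z) (a - z) = r at *
  generalize dotp (y - z) (b - z) = s at *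
  generalize Real.sin (InnerProductGeometry.angle (y - z) (a - z)) = s₁ at *
  generalize Real.sin (InnerProductGeometry.angle (y - z) (b - z)) = s₂ at *
  generalize Real.cos (InnerProductGeometry.angle (y - z) (a - z)) = c₁ at *
  generalize Real.cos (InnerProductGeometry.angle (y - z) (b - z)) = c₂ at *
  have hna : 0 ≤ ‖y - z‖ * ‖a - z‖ := by positivity
  have hnb : 0 ≤ ‖y - z‖ * ‖b - z‖ := by positivity
  generalize ‖y - z‖ * ‖a - z‖ = m at *
  generalize ‖y - z‖ * ‖b - z‖ = n at *
  have hpm : |p| ≤ m := by nlinarith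
  have hqn : |q| ≤ n := by nlinarith
  have hpq : 0 < |p| * |q| := mul_pos (abs_pos.2 ha0) (abs_pos.2 hb0)
  -- As `p` and `q` have opposite signs, the addition formula for the sine and the difference of the
  -- signed cotangents have the same numerator. The denominators are `m * n` and `|p| * |q|`, and
  -- the latter is smaller because sines are at most 1.
  have h1 : |s₁ * c₂ + c₁ * s₂| * (m * n) = |p * s - r * q| := by
    rw [← abs_of_nonneg (mul_nonneg hna hnb), ← abs_mul]
    have e : (s₁ * c₂ + c₁ * s₂) * (m * n) = |p| * s + r * |q| := by
      rw [← sa, ← sb, ← ca, ← cb]; ring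
    rw [e]
    rcases lt_or_gt_of_ne ha0 with hp | hp
    · have hq : 0 < q := by nlinarith
      rw [abs_of_neg hp, abs_of_pos hq, ← abs_neg]; congr 1; ring
    · have hq : q < 0 := by nlinarith
      rw [abs_of_neg hq, abs_of_pos hp]; congr 1; ring
  have h2 : |-(r / p) - -(s / q)| * (|p| * |q|) = |p * s - r * q| := by
    rw [← abs_mul, ← abs_mul]; congr 1; field_simp; ring
  have h3 : |p| * |q| ≤ m * n := by gcongr
  refine le_of_mul_le_mul_right ?_ hpq
  rw [h2, ← h1]
  exact mul_le_mul_of_nonneg_left h3 (abs_nonneg _)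

/-! ### The field of an edge -/

/-- The hat function of `y`, on the triangles `z y a` and `z y b`. -/
def edgeHat (z y a b x : Plane) : ℝ :=
  dotp (x - z) (y - z) / dotp (y - z) (y - z) -
    (dotp (a - z) (y - z) / dotp (y - z) (y - z) * max 0 (dual (a - z) (y - z) (x - z)) +
      dotp (b - z) (y - z) / dotp (y - z) (y - z) * max 0 (dual (b - z) (y - z) (x - z)))

/-- The hat function of `z`, on the triangles `z y a` and `z y b`. -/
def edgeHat' (z y a b x : Plane) : ℝ :=
  1 - edgeHat z y a b x -
    (max 0 (dual (a - z) (y - z) (x - z)) + max 0 (dual (b - z) (y - z) (x - z)))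

/-- The field of the edge `z y`, supported on the triangles `z y a` and `z y b`. -/
def edgeField (z y a b : Plane) (μ γ : ℝ) (x : Plane) : Plane :=
  (max 0 (edgeHat' z y a b x) ^ 2 * max 0 (edgeHat z y a b x)) •
    (μ • (y - z) + (γ * (edgeHat' z y a b x - 3 / 2 * edgeHat z y a b x)) • rot (y - z))

lemma edgeHat_swap (z y a b x : Plane) : edgeHat z y a b x = edgeHat z y b a x := by
  simp only [edgeHat]; ring

lemma edgeHat'_swap (z y a b x : Plane) : edgeHat' z y a b x = edgeHat' z y b a x := by
  simp only [edgeHat', edgeHat_swap z y a b]; ring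

lemma edgeField_swap (z y a b : Plane) (μ γ : ℝ) :
    edgeField z y a b μ γ = edgeField z y b a μ γ := by
  ext1 x
  simp only [edgeField, edgeHat_swap z y a b, edgeHat'_swap z y a b]

lemma continuous_edgeHat (z y a b : Plane) : Continuous (edgeHat z y a b) := by
  unfold edgeHat
  have h1 : Continuous fun x : Plane => dual (a - z) (y - z) (x - z) := by fun_prop
  have h2 : Continuous fun x : Plane => dual (b - z) (y - z) (x - z) := by fun_prop
  have h3 : Continuous fun x : Plane => dotp (x - z) (y - z) := by unfold dotp; fun_prop
  fun_prop

lemma continuous_edgeHat' (z y a b : Plane) : Continuous (edgeHat' z y a b) := by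
  have h0 := continuous_edgeHat z y a b
  unfold edgeHat'
  have h1 : Continuous fun x : Plane => dual (a - z) (y - z) (x - z) := by fun_prop
  have h2 : Continuous fun x : Plane => dual (b - z) (y - z) (x - z) := by fun_prop
  fun_prop

lemma continuous_edgeField (z y a b : Plane) (μ γ : ℝ) : Continuous (edgeField z y a b μ γ) := by
  have h0 := continuous_edgeHat z y a b
  have h1 := continuous_edgeHat' z y a b
  unfold edgeField
  fun_prop

section
variable {z y a b x : Plane}

lemma dotp_self_ne_zero {u v : Plane} (h : cross u v ≠ 0) : dotp u u ≠ 0 := by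
  have := norm_pos_iff.2 (ne_zero_of_cross h)
  have h2 := norm_sq_eq u
  have : 0 < ‖u‖ ^ 2 := by positivity
  simp only [dotp]
  nlinarith

/-- On the side of `a` the term of `b` is cut off. Pairing the expansion of `x - z` in `y - z` and
`a - z` with `y - z` shows that the projection exceeds the coordinate of `y` by exactly the
subtracted multiple of the coordinate of `a`. -/
lemma edgeHat_of_nonneg (h : cross (y - z) (a - z) * cross (y - z) (b - z) < 0)
    (hx : 0 ≤ dual (a - z) (y - z) (x - z)) :
    edgeHat z y a b x = dual (y - z) (a - z) (x - z) ∧ edgeHat' z y a b x =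
      1 - dual (y - z) (a - z) (x - z) - dual (a - z) (y - z) (x - z) := by
  have ha0 : cross (y - z) (a - z) ≠ 0 := fun h0 => by simp [h0] at h
  have hb0 : cross (y - z) (b - z) ≠ 0 := fun h0 => by simp [h0] at h
  have hn := dotp_self_ne_zero ha0
  have hb : dual (b - z) (y - z) (x - z) ≤ 0 := by
    have : dual (b - z) (y - z) (x - z) = dual (a - z) (y - z) (x - z) *
        (cross (y - z) (a - z) * cross (y - z) (b - z) / cross (y - z) (b - z) ^ 2) := by
      rw [dual_apply, dual_apply, cross_swap (b - z), cross_swap (a - z)]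
      field_simp
    rw [this]
    exact mul_nonpos_of_nonneg_of_nonpos hx (div_nonpos_of_nonpos_of_nonneg h.le (sq_nonneg _))
  have h1 : edgeHat z y a b x = dual (y - z) (a - z) (x - z) := by
    rw [edgeHat, max_eq_right hx, max_eq_left hb, dual_apply, dual_apply, cross_swap (a - z)]
    field_simp
    simp only [dotp, cross]; ring
  refine ⟨h1, ?_⟩
  rw [edgeHat', h1, max_eq_right hx, max_eq_left hb]; ring

lemma edgeField_eq_sideField (h : cross (y - z) (a - z) * cross (y - z) (b - z) < 0) (μ γ : ℝ)
    (hx : x ∈ convexHull ℝ (tri z y a : Set Plane)) :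
    edgeField z y a b μ γ x = sideField z y a μ γ x := by
  have ha0 : cross (y - z) (a - z) ≠ 0 := fun h0 => by simp [h0] at h
  obtain ⟨h1, h2, h3⟩ := (mem_hull_iff ha0 x).1 hx
  obtain ⟨h4, h5⟩ := edgeHat_of_nonneg h h2
  rw [edgeField, sideField, polyField, h4, h5, max_eq_right h1, max_eq_right (by linarith)]
  simp only [neg_apply, add_apply]
  have e : (1 + -(dual (y - z) (a - z) (x - z) + dual (a - z) (y - z) (x - z))) =
    1 - dual (y - z) (a - z) (x - z) - dual (a - z) (y - z) (x - z) := by ring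
  rw [e]

lemma mem_hull_of_edgeHat_pos (h : cross (y - z) (a - z) * cross (y - z) (b - z) < 0)
    (hx : 0 ≤ dual (a - z) (y - z) (x - z)) (hy : 0 < edgeHat z y a b x)
    (hz : 0 < edgeHat' z y a b x) : x ∈ convexHull ℝ (tri z y a : Set Plane) := by
  have ha0 : cross (y - z) (a - z) ≠ 0 := fun h0 => by simp [h0] at h
  obtain ⟨h4, h5⟩ := edgeHat_of_nonneg h hx
  rw [mem_hull_iff ha0]
  rw [h4] at hy
  rw [h5] at hz
  exact ⟨hy.le, hx, by linarith⟩

/-- The positive parts in `edgeField` force the coordinates of `z` and `y` to be positive, and on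
either side of the edge line the coordinate of the third vertex is nonnegative. -/
lemma mem_hull_of_edgeField_ne_zero (h : cross (y - z) (a - z) * cross (y - z) (b - z) < 0)
    {μ γ : ℝ} (hx : edgeField z y a b μ γ x ≠ 0) :
    x ∈ convexHull ℝ (tri z y a : Set Plane) ∨ x ∈ convexHull ℝ (tri z y b : Set Plane) := by
  have hy : 0 < edgeHat z y a b x := by
    by_contra hcon
    exact hx (by rw [edgeField, max_eq_left (not_lt.1 hcon)]; simp)
  have hz : 0 < edgeHat' z y a b x := by
    by_contra hcon
    exact hx (by rw [edgeField, max_eq_left (not_lt.1 hcon)]; simp)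
  rcases le_or_gt 0 (dual (a - z) (y - z) (x - z)) with h0 | h0
  · exact Or.inl (mem_hull_of_edgeHat_pos h h0 hy hz)
  · right
    have ha0 : cross (y - z) (a - z) ≠ 0 := fun h0 => by simp [h0] at h
    have hb0 : cross (y - z) (b - z) ≠ 0 := fun h0 => by simp [h0] at h
    refine mem_hull_of_edgeHat_pos (b := a) (by rwa [mul_comm]) ?_ (by rwa [edgeHat_swap])
      (by rwa [edgeHat'_swap])
    have : dual (b - z) (y - z) (x - z) = dual (a - z) (y - z) (x - z) *
        (cross (y - z) (a - z) * cross (y - z) (b - z) / cross (y - z) (b - z) ^ 2) := by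
      rw [dual_apply, dual_apply, cross_swap (b - z), cross_swap (a - z)]
      field_simp
    rw [this]
    exact mul_nonneg_of_nonpos_of_nonpos h0.le
      (div_nonpos_of_nonpos_of_nonneg h.le (sq_nonneg _))

end

/-! ### Correctors -/

variable {Ω : Set Plane}

/-- A field supported in the patch of `z` whose divergence takes the value `d T` at `z` on each
triangle `T` of the patch, vanishes at the other vertices, and has mean zero on each triangle. -/
structure IsCorrector (M : Triangulation Ω) (z : Plane) (k : ℕ) (B : ℝ) (d : Finset Plane → ℝ)
    (v : Plane → Plane) : Prop where
  continuous : Continuous v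
  eq_zero : ∀ x, x ∉ Ω → v x = 0
  support : tsupport v ⊆ M.patch z
  localCorrector : ∀ T ∈ M.triangles, LocalCorrector T z k B (d T) v

namespace IsCorrector
variable {M : Triangulation Ω} {z : Plane} {k l : ℕ} {B B' : ℝ} {d d' : Finset Plane → ℝ}
  {v w : Plane → Plane}

lemma mono (h : IsCorrector M z k B d v) (hB : B ≤ B') (hk : k ≤ l) :
    IsCorrector M z l B' d v :=
  { h with localCorrector := fun T hT => (h.localCorrector T hT).mono hB hk }

lemma zero (M : Triangulation Ω) (z : Plane) (k : ℕ) (hB : 0 ≤ B) :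
    IsCorrector M z k B (fun _ => 0) (fun _ => 0) :=
  ⟨continuous_const, fun _ _ => rfl, by simp [tsupport],
    fun T _ => LocalCorrector.zero T z k hB⟩

lemma add (hv : IsCorrector M z k B d v) (hw : IsCorrector M z k B' d' w) :
    IsCorrector M z k (B + B') (fun T => d T + d' T) (fun x => v x + w x) :=
  ⟨hv.continuous.add hw.continuous, fun x hx => by simp [hv.eq_zero x hx, hw.eq_zero x hx],
    (tsupport_add v w).trans (Set.union_subset hv.support hw.support),
    fun T hT => (hv.localCorrector T hT).add (hw.localCorrector T hT)⟩

lemma smul (hv : IsCorrector M z k B d v) (c : ℝ) :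
    IsCorrector M z k (|c| * B) (fun T => c * d T) (fun x => c • v x) :=
  ⟨hv.continuous.const_smul c, fun x hx => by simp [hv.eq_zero x hx],
    (closure_mono (Function.support_const_smul_subset c v)).trans hv.support,
    fun T hT => (hv.localCorrector T hT).smul c⟩

-- The set where the field is nonzero is open and contained in the closure of `Ω`, hence in `Ω`
-- itself, because `Ω` is the interior of its closure. On any other triangle the field vanishes in
-- the interior, and on the edges by continuity.
open scoped Classical in
lemma edgeField {y a b : Plane} {ρ μ γ : ℝ} (hΩ : IsRegularDomain Ω) (hρ : 0 < ρ)
    (hM : M.ShapeRegular ρ) (ha : tri z y a ∈ M.triangles) (hb : tri z y b ∈ M.triangles)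
    (hne : tri z y a ≠ tri z y b) (hk : 4 ≤ k ∨ γ = 0 ∧ 3 ≤ k) :
    IsCorrector M z k ((3 * |μ| + 7 * |γ|) * (1 / ρ))
      (fun T => if T = tri z y a then μ + γ * normalRate z y a else
        if T = tri z y b then μ + γ * normalRate z y b else 0)
      (ScottVogelius.edgeField z y a b μ γ) := by
  have hab := Triangulation.cross_mul_cross_neg ha hb hne
  have hcont := continuous_edgeField z y a b μ γ
  have hsupp : ∀ x, ScottVogelius.edgeField z y a b μ γ x ≠ 0 →
      x ∈ convexHull ℝ (tri z y a : Set Plane) ∪ convexHull ℝ (tri z y b : Set Plane) :=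
    fun x hx => mem_hull_of_edgeField_ne_zero hab hx
  have hopen : IsOpen {x | ScottVogelius.edgeField z y a b μ γ x ≠ 0} :=
    isOpen_ne_fun hcont continuous_const
  refine ⟨hcont, fun x hx => ?_, ?_, fun T hT => ?_⟩
  · by_contra hcon
    refine hx ?_
    rw [← hΩ.interior_closure]
    refine interior_maximal (fun w hw => ?_) hopen hcon
    rw [← M.space_eq]
    rcases hsupp w hw with h | h
    · exact M.convexHull_subset_space ha.1 h
    · exact M.convexHull_subset_space hb.1 h
  · refine (closure_minimal hsupp ((Triangulation.isClosed_hull _).union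
      (Triangulation.isClosed_hull _))).trans (Set.union_subset ?_ ?_)
    · exact Set.subset_biUnion_of_mem (u := fun T : Finset Plane => convexHull ℝ (T : Set Plane))
        (show tri z y a ∈ M.trianglesAt z from ⟨ha, by simp [tri]⟩)
    · exact Set.subset_biUnion_of_mem (u := fun T : Finset Plane => convexHull ℝ (T : Set Plane))
        (show tri z y b ∈ M.trianglesAt z from ⟨hb, by simp [tri]⟩)
  · by_cases h1 : T = tri z y a
    · subst h1
      rw [if_pos rfl]
      exact (localCorrector_sideField (Triangulation.cross_ne_zero ha) hρ (hM _ ha) hk).congr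
        fun x hx => edgeField_eq_sideField hab μ γ hx
    by_cases h2 : T = tri z y b
    · subst h2
      rw [if_neg h1, if_pos rfl, edgeField_swap]
      exact (localCorrector_sideField (Triangulation.cross_ne_zero hb) hρ (hM _ hb) hk).congr
        fun x hx => edgeField_eq_sideField (by rwa [mul_comm]) μ γ hx
    rw [if_neg h1, if_neg h2]
    refine (LocalCorrector.zero T z k (by positivity)).congr fun x hx => ?_
    rw [← Triangulation.closure_interior_hull hT] at hx
    have h0 : Set.EqOn (ScottVogelius.edgeField z y a b μ γ) (fun _ => 0)
        (interior (convexHull ℝ (T : Set Plane))) := by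
      intro w hw
      by_contra hcon
      rcases hsupp w hcon with h | h
      · exact Set.disjoint_left.1 (Triangulation.hull_disjoint_interior ha hT (Ne.symm h1)) h hw
      · exact Set.disjoint_left.1 (Triangulation.hull_disjoint_interior hb hT (Ne.symm h2)) h hw
    exact h0.closure hcont continuous_const hx

end IsCorrector

/-! ### Alternating sums -/

/-- The alternating sum of the first `n` terms of a sequence, the last one counted positively. -/
def altPart (a : ℕ → ℝ) (n : ℕ) : ℝ :=
  ∑ j ∈ Finset.range n, (-1) ^ (n - (j + 1)) * a j

lemma altPart_zero (a : ℕ → ℝ) : altPart a 0 = 0 := by simp [altPart]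

/-- This is the recursion of the walk around `z`: what triangle `n` still lacks once it has received
`altPart a n` from the preceding edge. -/
lemma altPart_succ (a : ℕ → ℝ) (n : ℕ) : altPart a (n + 1) = a n - altPart a n := by
  have : ∑ j ∈ Finset.range n, (-1 : ℝ) ^ (n + 1 - (j + 1)) * a j =
      -∑ j ∈ Finset.range n, (-1 : ℝ) ^ (n - (j + 1)) * a j := by
    rw [← Finset.sum_neg_distrib]
    refine Finset.sum_congr rfl fun j hj => ?_
    have hj := Finset.mem_range.1 hj
    have : n + 1 - (j + 1) = (n - (j + 1)) + 1 := by omega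
    rw [this, pow_succ]; ring
  rw [altPart, Finset.sum_range_succ, this, altPart]
  simp; ring

lemma abs_altPart_le {a : ℕ → ℝ} {A : ℝ} {n : ℕ} (h : ∀ j < n, |a j| ≤ A) :
    |altPart a n| ≤ n * A := by
  induction n with
  | zero => simp [altPart_zero]
  | succ n ih =>
    rw [altPart_succ]
    have h1 := ih fun j hj => h j (by omega)
    have h2 := h n (by omega)
    have h3 := abs_sub (a n) (altPart a n)
    push_cast; linarith

lemma altPart_sub_mul (a b : ℕ → ℝ) (c : ℝ) (n : ℕ) :
    altPart (fun j => a j - c * b j) n = altPart a n - c * altPart b n := by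
  simp only [altPart, Finset.mul_sum, ← Finset.sum_sub_distrib]
  exact Finset.sum_congr rfl fun j _ => by ring

lemma altPart_pair {p q n : ℕ} (hp : p < n) (hq : q < n) (hpq : p ≠ q) (α β : ℝ) :
    altPart (fun j => if j = p then α else if j = q then β else 0) n =
      (-1) ^ (n - (p + 1)) * α + (-1) ^ (n - (q + 1)) * β := by
  have : ∀ j, (-1 : ℝ) ^ (n - (j + 1)) * (if j = p then α else if j = q then β else 0) =
      (if j = p then (-1) ^ (n - (p + 1)) * α else 0) +
        (if j = q then (-1) ^ (n - (q + 1)) * β else 0) := by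
    intro j
    by_cases h1 : j = p
    · subst h1; simp [hpq]
    · by_cases h2 : j = q
      · subst h2; simp [h1]
      · simp [h1, h2]
  simp only [altPart, this, Finset.sum_add_distrib]
  simp [hp, hq]

lemma altPart_congr {a b : ℕ → ℝ} {n : ℕ} (h : ∀ j < n, a j = b j) : altPart a n = altPart b n :=
  Finset.sum_congr rfl fun j hj => by rw [h j (Finset.mem_range.1 hj)]

/-! ### Correctors with prescribed values around a vertex -/

namespace VertexEnumeration
variable {Ω : Set Plane} {M : Triangulation Ω} (e : VertexEnumeration M) {z : Plane}

lemma num_pos (hz : z ∈ M.vertexSet) : 0 < e.num z := by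
  obtain ⟨T, hT, hzT, hc⟩ := M.pure {z} hz
  obtain ⟨j, hj, -⟩ := e.surjective z hz T ⟨⟨hT, hc⟩, hzT (by simp)⟩
  omega

lemma triangle_mem (hz : z ∈ M.vertexSet) {j : ℕ} (hj : j < e.num z) :
    e.triangle z j ∈ M.triangles := e.mem_triangles z hz j hj

lemma exists_pairCorrector {y a b : Plane} {ρ : ℝ} {k i j : ℕ} (hΩ : IsRegularDomain Ω)
    (hρ : 0 < ρ) (hM : M.ShapeRegular ρ) (hz : z ∈ M.vertexSet) (hi : i < e.num z)
    (hj : j < e.num z) (hij : i ≠ j) (hia : e.triangle z i = tri z y a)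
    (hjb : e.triangle z j = tri z y b) (μ γ : ℝ) (hk : 4 ≤ k ∨ γ = 0 ∧ 3 ≤ k) :
    ∃ d v, IsCorrector M z k ((3 * |μ| + 7 * |γ|) * (1 / ρ)) d v ∧ ∀ l < e.num z,
      d (e.triangle z l) = if l = i then μ + γ * normalRate z y a else
        if l = j then μ + γ * normalRate z y b else 0 := by
  have hinj : ∀ l < e.num z, ∀ m < e.num z, e.triangle z l = e.triangle z m ↔ l = m :=
    fun l hl m hm => ⟨e.injective z hz l hl m hm, fun h => by rw [h]⟩
  have hne : tri z y a ≠ tri z y b := by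
    rw [← hia, ← hjb, Ne, hinj i hi j hj]; exact hij
  have ha : tri z y a ∈ M.triangles := hia ▸ e.triangle_mem hz hi
  have hb : tri z y b ∈ M.triangles := hjb ▸ e.triangle_mem hz hj
  refine ⟨_, _, IsCorrector.edgeField (μ := μ) (γ := γ) hΩ hρ hM ha hb hne hk, fun l hl => ?_⟩
  simp only [← hia, ← hjb, hinj l hl i hi, hinj l hl j hj]

/-- After `n` edges the earlier triangles are correct and triangle `n` carries `altPart a n`. The
tangential field of the next edge, with coefficient `altPart a (n + 1)`, completes triangle `n` to
`a n` and puts the same amount on triangle `n + 1`. -/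
lemma exists_chainCorrector {ρ A : ℝ} {a : ℕ → ℝ} (hΩ : IsRegularDomain Ω)
    (hρ : 0 < ρ) (hM : M.ShapeRegular ρ) (hz : z ∈ M.vertexSet)
    (ha : ∀ j < e.num z, |a j| ≤ A) (n : ℕ) (hn : n + 1 ≤ e.num z) :
    ∃ d v, IsCorrector M z 3 (n * (3 * (e.num z * A) * (1 / ρ))) d v ∧ ∀ i < e.num z,
      d (e.triangle z i) = if i < n then a i else if i = n then altPart a n else 0 := by
  induction n with
  | zero =>
    refine ⟨_, _, IsCorrector.zero M z 3 (by simp), fun i _ => ?_⟩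
    simp [altPart_zero]
  | succ n ih =>
    obtain ⟨d, v, hv, hd⟩ := ih (by omega)
    obtain ⟨d', v', hv', hd'⟩ := e.exists_pairCorrector (k := 3) (i := n) (j := n + 1)
      (y := e.nbr z (n + 1)) (a := e.nbr z n) (b := e.nbr z (n + 2)) hΩ hρ hM hz (by omega)
      (by omega) (by omega) (tri_swap _ _ _) rfl (altPart a (n + 1)) 0 (Or.inr ⟨rfl, le_rfl⟩)
    refine ⟨_, _, (hv.add hv').mono (B' := (n + 1 : ℕ) * (3 * (e.num z * A) * (1 / ρ))) ?_ le_rfl,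
      fun i hi => ?_⟩
    · have hA : 0 ≤ A := (abs_nonneg _).trans (ha 0 (by omega))
      have h1 : |altPart a (n + 1)| ≤ e.num z * A := by
        refine (abs_altPart_le fun j hj => ha j (by omega)).trans ?_
        gcongr
        omega
      have h2 : 3 * |altPart a (n + 1)| * (1 / ρ) ≤ 3 * (e.num z * A) * (1 / ρ) := by gcongr
      push_cast
      simp only [abs_zero, mul_zero, add_zero]
      linarith
    · rw [hd i hi, hd' i hi]
      have hs := altPart_succ a n
      rcases lt_trichotomy i n with h | h | h
      · rw [if_pos h, if_neg (by omega), if_neg (by omega), if_pos (by omega), add_zero]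
      · subst h
        simp; linarith
      · rw [if_neg (by omega), if_neg (by omega), if_neg (by omega),
          if_neg (show ¬i < n + 1 by omega)]
        simp

lemma exists_corrector_of_altPart {ρ A : ℝ} {a : ℕ → ℝ} (hΩ : IsRegularDomain Ω)
    (hρ : 0 < ρ) (hM : M.ShapeRegular ρ) (hz : z ∈ M.vertexSet)
    (ha : ∀ j < e.num z, |a j| ≤ A) (h0 : altPart a (e.num z) = 0) :
    ∃ d v, IsCorrector M z 3 (3 * e.num z ^ 2 * A * (1 / ρ)) d v ∧ ∀ i < e.num z,
      d (e.triangle z i) = a i := by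
  have hN := e.num_pos hz
  obtain ⟨n, hn⟩ : ∃ n, e.num z = n + 1 := ⟨e.num z - 1, by omega⟩
  obtain ⟨d, v, hv, hd⟩ := e.exists_chainCorrector hΩ hρ hM hz ha n hn.ge
  refine ⟨d, v, hv.mono ?_ le_rfl, fun i hi => ?_⟩
  · have hA : 0 ≤ A := (abs_nonneg _).trans (ha 0 (by omega))
    have h1 : (n : ℝ) ≤ e.num z := by rw [hn]; push_cast; linarith
    calc (n : ℝ) * (3 * (e.num z * A) * (1 / ρ)) ≤ e.num z * (3 * (e.num z * A) * (1 / ρ)) := by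
          gcongr
      _ = _ := by ring
  · rw [hd i hi]
    rcases lt_or_ge i n with h | h
    · rw [if_pos h]
    · have : i = n := by omega
      subst this
      -- On the last triangle the vanishing alternating sum says that the amount carried over is
      -- already the right value.
      rw [hn, altPart_succ] at h0
      simp; linarith

lemma exists_pair (hz : z ∈ M.vertexSet) {j : ℕ} (hj : j < e.numPairs z) :
    ∃ y a b q, j < e.num z ∧ q < e.num z ∧ j ≠ q ∧ e.triangle z j = tri z y a ∧
      e.triangle z q = tri z y b ∧
      e.angleSum z j = EuclideanGeometry.angle a z y + EuclideanGeometry.angle y z b ∧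
      (q = j + 1 ∨ j + 1 = e.num z ∧ q = 0) := by
  by_cases hlt : j + 1 < e.num z
  · refine ⟨e.nbr z (j + 1), e.nbr z j, e.nbr z (j + 2), j + 1, by omega, hlt, by omega,
      tri_swap _ _ _, rfl, ?_, Or.inl rfl⟩
    rw [angleSum, Nat.mod_eq_of_lt hlt]; rfl
  · have hN := e.num_pos hz
    have hzΩ : z ∈ Ω := by
      by_contra hcon
      rw [numPairs, if_neg hcon] at hj
      omega
    rw [numPairs, if_pos hzΩ] at hj
    have hjN : j + 1 = e.num z := by omega
    have hnbr := e.interior_vertex z hz hzΩ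
    -- A cycle consisting of one triangle would have two equal vertices.
    have hj0 : j ≠ 0 := by
      rintro rfl
      have hmem := e.mem_triangles z hz 0 hN
      rw [hjN, hnbr] at hmem
      have := Triangulation.cross_ne_zero hmem
      exact this (by simp only [cross]; ring)
    refine ⟨e.nbr z 0, e.nbr z j, e.nbr z 1, 0, hj, hN, hj0, ?_, rfl, ?_, Or.inr ⟨hjN, rfl⟩⟩
    · rw [triangle, hjN, hnbr, tri_swap]
    · rw [angleSum, hjN, Nat.mod_self, angle, angle, hjN, hnbr]

/-- Both angles lie strictly between 0 and `π`, and on `(0, 2π)` the sine vanishes only at `π`. This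
is why `Γ(z) > 0` gives `Θ(z) > 0`. -/
lemma sin_angleSum_ne_zero (hz : z ∈ M.vertexSet) {j : ℕ} (hj : j < e.numPairs z)
    (hne : e.angleSum z j ≠ Real.pi) : Real.sin (e.angleSum z j) ≠ 0 := by
  obtain ⟨y, a, b, q, hjN, hqN, -, hja, hqb, hs, -⟩ := e.exists_pair hz hj
  have ha : cross (y - z) (a - z) ≠ 0 :=
    Triangulation.cross_ne_zero (hja ▸ e.triangle_mem hz hjN)
  have ha' : cross (a - z) (y - z) ≠ 0 := by rw [cross_swap]; simpa using ha
  have hb : cross (y - z) (b - z) ≠ 0 :=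
    Triangulation.cross_ne_zero (hqb ▸ e.triangle_mem hz hqN)
  have h1 : 0 < EuclideanGeometry.angle a z y := angle_pos_of_cross ha'
  have h2 : EuclideanGeometry.angle a z y < Real.pi := angle_lt_pi_of_cross ha'
  have h3 : 0 < EuclideanGeometry.angle y z b := angle_pos_of_cross hb
  have h4 : EuclideanGeometry.angle y z b < Real.pi := angle_lt_pi_of_cross hb
  rcases lt_or_gt_of_ne hne with h | h
  · exact (Real.sin_pos_of_pos_of_lt_pi (by linarith) h).ne'
  · have := Real.sin_pos_of_pos_of_lt_pi (x := e.angleSum z j - Real.pi) (by linarith) (by linarith)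
    rw [Real.sin_sub_pi] at this
    linarith

lemma exists_Theta_eq (hz : z ∈ M.vertexSet) (hns : e.IsNonsingular z) :
    0 < e.Theta z ∧ ∃ j < e.numPairs z, e.Theta z = |Real.sin (e.angleSum z j)| := by
  -- An empty supremum is 0, so `Γ(z) > 0` provides at least one pair.
  have hne : Nonempty (Fin (e.numPairs z)) := by
    by_contra hcon
    rw [not_nonempty_iff] at hcon
    rw [IsNonsingular, Gam, Real.iSup_of_isEmpty] at hns
    exact hns.false
  obtain ⟨i, hi⟩ := exists_eq_ciSup_of_finite
    (f := fun j : Fin (e.numPairs z) => |e.angleSum z j - Real.pi|)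
  obtain ⟨j, hj⟩ := exists_eq_ciSup_of_finite
    (f := fun j : Fin (e.numPairs z) => |Real.sin (e.angleSum z j)|)
  refine ⟨?_, j, j.2, hj.symm⟩
  have h1 : e.angleSum z i ≠ Real.pi := by
    intro h
    rw [IsNonsingular, Gam, ← hi, h] at hns
    simp at hns
  have h2 : |Real.sin (e.angleSum z i)| ≤ e.Theta z :=
    le_ciSup (f := fun j : Fin (e.numPairs z) => |Real.sin (e.angleSum z j)|)
      (Set.finite_range _).bddAbove i
  exact (abs_pos.2 (e.sin_angleSum_ne_zero hz i.2 h1)).trans_le h2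

lemma exists_altCorrector {ρ : ℝ} (hΩ : IsRegularDomain Ω) (hρ : 0 < ρ) (hM : M.ShapeRegular ρ)
    (hz : z ∈ M.vertexSet) (hns : e.IsNonsingular z) :
    ∃ d v, IsCorrector M z 4 (7 * (1 / ρ)) d v ∧
      (∀ i < e.num z, |d (e.triangle z i)| ≤ 1 + 1 / ρ) ∧
      e.Theta z ≤ |altPart (fun i => d (e.triangle z i)) (e.num z)| := by
  obtain ⟨-, j, hj, hΘ⟩ := e.exists_Theta_eq hz hns
  obtain ⟨y, a, b, q, hjN, hqN, hjq, hja, hqb, hs, hcase⟩ := e.exists_pair hz hj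
  have hta : tri z y a ∈ M.triangles := hja ▸ e.triangle_mem hz hjN
  have htb : tri z y b ∈ M.triangles := hqb ▸ e.triangle_mem hz hqN
  have hne : tri z y a ≠ tri z y b := by
    rw [← hja, ← hqb]; exact fun h => hjq (e.injective z hz j hjN q hqN h)
  have hρ' : 0 < 1 / ρ := by positivity
  -- Only for the closing pair of an odd cycle do the two triangles carry equal signs. Then the
  -- tangential field (`μ = 1`, `γ = 0`) has alternating sum 2; in all other cases the normal field
  -- (`μ = 0`, `γ = 1`) has the jump of `normalRate`.
  by_cases hodd : q = 0 ∧ j + 1 = e.num z ∧ Odd (e.num z)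
  · obtain ⟨d, v, hv, hd⟩ := e.exists_pairCorrector (k := 4) hΩ hρ hM hz hjN hqN hjq hja hqb 1 0
      (Or.inl le_rfl)
    refine ⟨d, v, hv.mono ?_ le_rfl, fun i hi => ?_, ?_⟩
    · simp only [abs_one, abs_zero]; nlinarith
    · rw [hd i hi]
      split_ifs <;> simp <;> positivity
    · rw [altPart_congr hd, altPart_pair hjN hqN hjq]
      obtain ⟨rfl, h2, m, hm⟩ := hodd
      have e1 : e.num z - (j + 1) = 0 := by omega
      have e2 : e.num z - (0 + 1) = 2 * m := by omega
      rw [e1, e2, pow_mul, hΘ]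
      have := Real.abs_sin_le_one (e.angleSum z j)
      norm_num
      linarith
  · obtain ⟨d, v, hv, hd⟩ := e.exists_pairCorrector (k := 4) hΩ hρ hM hz hjN hqN hjq hja hqb 0 1
      (Or.inl le_rfl)
    refine ⟨d, v, hv.mono ?_ le_rfl, fun i hi => ?_, ?_⟩
    · simp
    · have ha := abs_normalRate_le (Triangulation.cross_ne_zero hta) hρ (hM _ hta)
      have hb := abs_normalRate_le (Triangulation.cross_ne_zero htb) hρ (hM _ htb)
      rw [hd i hi]
      split_ifs <;> simp only [zero_add, one_mul, abs_zero] <;> linarith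
    · rw [altPart_congr hd, altPart_pair hjN hqN hjq, hΘ, hs]
      refine (abs_sin_add_le (Triangulation.cross_mul_cross_neg hta htb hne)).trans (le_of_eq ?_)
      simp only [zero_add, one_mul]
      rcases hcase with rfl | ⟨h1, rfl⟩
      · have e1 : e.num z - (j + 1) = (e.num z - (j + 1 + 1)) + 1 := by omega
        rw [e1, pow_succ]
        have e2 : ∀ c u w : ℝ, c * -1 * u + c * w = c * (w - u) := by intros; ring
        rw [e2, abs_mul, abs_pow]
        simp [abs_sub_comm]
      · have hev : Even (e.num z) := by
          rw [← Nat.not_odd_iff_even]; exact fun h => hodd ⟨rfl, h1, h⟩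
        obtain ⟨m, hm⟩ := hev
        have e1 : e.num z - (j + 1) = 0 := by omega
        have e2 : e.num z - (0 + 1) = 2 * (m - 1) + 1 := by omega
        rw [e1, e2, pow_succ, pow_mul]
        norm_num [sub_eq_add_neg]

/-- At a non-singular vertex, arbitrary values can be prescribed. -/
lemma exists_corrector_of_nonsingular {ρ A : ℝ} {a : ℕ → ℝ} (hΩ : IsRegularDomain Ω)
    (hρ : 0 < ρ) (hM : M.ShapeRegular ρ) (hz : z ∈ M.vertexSet) (hns : e.IsNonsingular z)
    (ha : ∀ j < e.num z, |a j| ≤ A) :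
    ∃ d v, IsCorrector M z 4 (e.num z * A / e.Theta z * (7 * (1 / ρ)) +
      3 * e.num z ^ 2 * (A + e.num z * A / e.Theta z * (1 + 1 / ρ)) * (1 / ρ)) d v ∧
      ∀ i < e.num z, d (e.triangle z i) = a i := by
  obtain ⟨hΘ, -⟩ := e.exists_Theta_eq hz hns
  obtain ⟨d, v, hv, hd, hΘd⟩ := e.exists_altCorrector hΩ hρ hM hz hns
  set δ := fun i => d (e.triangle z i) with hδ
  have hne : altPart δ (e.num z) ≠ 0 := abs_pos.1 (hΘ.trans_le hΘd)
  -- This multiple absorbs the whole alternating sum of `a`, leaving a remainder that cubic fields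
  -- can realize.
  set γ := altPart a (e.num z) / altPart δ (e.num z) with hγ
  have hA : 0 ≤ A := (abs_nonneg _).trans (ha 0 (e.num_pos hz))
  have hγA : |γ| ≤ e.num z * A / e.Theta z := by
    rw [hγ, abs_div]
    exact div_le_div₀ (by positivity) (abs_altPart_le ha) hΘ hΘd
  obtain ⟨d', v', hv', hd'⟩ := e.exists_corrector_of_altPart (a := fun j => a j - γ * δ j)
    (A := A + e.num z * A / e.Theta z * (1 + 1 / ρ)) hΩ hρ hM hz
    (fun j hj => by
      refine (abs_sub _ _).trans (add_le_add (ha j hj) ?_)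
      rw [abs_mul]
      exact mul_le_mul hγA (hd j hj) (abs_nonneg _) (by positivity))
    (by rw [altPart_sub_mul, hγ]; field_simp; ring)
  refine ⟨_, _, ((hv.smul γ).add (hv'.mono le_rfl (by norm_num))).mono ?_ le_rfl, fun i hi => ?_⟩
  · gcongr
  · rw [hd' i hi]; simp only [hδ]; ring

end VertexEnumeration

/-! ### The number and the sizes of the triangles around a vertex -/

/-- The diameter of a triangle. -/
def triDiam (T : Finset Plane) : ℝ := Metric.diam (convexHull ℝ (T : Set Plane))

/-- The area of the unit disc. -/
def unitArea : ℝ := volume.real (Metric.ball (0 : Plane) 1)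

lemma unitArea_pos : 0 < unitArea := by
  refine ENNReal.toReal_pos (Metric.measure_ball_pos volume 0 one_pos).ne' measure_ball_lt_top.ne

lemma volume_real_ball (c : Plane) {r : ℝ} (hr : 0 ≤ r) :
    volume.real (Metric.ball c r) = r ^ 2 * unitArea := by
  rw [measureReal_def, Measure.addHaar_ball volume c hr, ENNReal.toReal_mul,
    ENNReal.toReal_ofReal (by positivity)]
  simp [unitArea, measureReal_def]

lemma volume_real_closedBall (c : Plane) {r : ℝ} (hr : 0 ≤ r) :
    volume.real (Metric.closedBall c r) = r ^ 2 * unitArea := by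
  rw [measureReal_def, Measure.addHaar_closedBall volume c hr, ENNReal.toReal_mul,
    ENNReal.toReal_ofReal (by positivity)]
  simp [unitArea, measureReal_def]

namespace Triangulation
variable {Ω : Set Plane} {M : Triangulation Ω} {ρ : ℝ} {z : Plane}

lemma triDiam_pos {T : Finset Plane} (hT : T ∈ M.triangles) : 0 < triDiam T := by
  obtain ⟨v, y, a, rfl⟩ := exists_eq_tri' hT
  have h0 : y - v ≠ 0 := ne_zero_of_cross (cross_ne_zero hT)
  exact (norm_pos_iff.2 h0).trans_le (norm_sub_le_diam (by simp [tri]) (by simp [tri]))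

/-- Every edge of a shape regular triangle is comparable to its diameter. -/
lemma mul_triDiam_le_edge {y a : Plane} (hρ : 0 < ρ) (hM : M.ShapeRegular ρ)
    (hT : tri z y a ∈ M.triangles) : ρ * triDiam (tri z y a) ≤ ‖y - z‖ := by
  have hc := cross_ne_zero hT
  obtain ⟨c, r, hb, hr⟩ := hM _ hT
  have hr : ρ * triDiam (tri z y a) ≤ 2 * r := hr
  have hr0 : 0 < r := by linarith [mul_pos hρ (triDiam_pos hT)]
  have h1 := opNorm_mul_le_one (C := 0) (z := z) (L := dual (y - z) (a - z)) hr0 hb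
    (fun x hx => by
      obtain ⟨h1, h2, h3⟩ := (mem_hull_iff hc x).1 hx
      constructor <;> linarith)
  have h2 := (dual (y - z) (a - z)).le_opNorm (y - z)
  rw [dual_left hc, norm_one] at h2
  refine hr.trans ?_
  nlinarith [norm_nonneg (y - z)]

lemma shape_le_one {T : Finset Plane} (hρ : 0 < ρ) (hM : M.ShapeRegular ρ)
    (hT : T ∈ M.triangles) : ρ ≤ 1 := by
  obtain ⟨v, y, a, rfl⟩ := exists_eq_tri' hT
  have h1 := mul_triDiam_le_edge hρ hM hT
  have h2 : ‖y - v‖ ≤ triDiam (tri v y a) := norm_sub_le_diam (by simp [tri]) (by simp [tri])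
  have h3 := triDiam_pos hT
  by_contra hcon
  nlinarith

lemma triDiam_adjacent {y a b : Plane} (hρ : 0 < ρ) (hM : M.ShapeRegular ρ)
    (ha : tri z y a ∈ M.triangles) : ρ * triDiam (tri z y a) ≤ triDiam (tri z y b) :=
  (mul_triDiam_le_edge hρ hM ha).trans (norm_sub_le_diam (by simp [tri]) (by simp [tri]))

lemma hull_subset_closedBall {T : Finset Plane} (hz : z ∈ T) :
    convexHull ℝ (T : Set Plane) ⊆ Metric.closedBall z (triDiam T) := fun _ hx =>
  Metric.dist_le_diam_of_mem (isCompact_hull T).isBounded hx (subset_convexHull ℝ _ hz)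

/-- Contracting towards a vertex keeps interior points interior; this allows triangles of different
sizes to be compared at a common scale. -/
lemma add_smul_mem_interior {T : Finset Plane} (hz : z ∈ T) {w : Plane} {s t : ℝ} (ht : 0 < t)
    (hts : t ≤ s) (hw : z + s • w ∈ interior (convexHull ℝ (T : Set Plane))) :
    z + t • w ∈ interior (convexHull ℝ (T : Set Plane)) := by
  have hs : 0 < s := ht.trans_le hts
  have := (convex_convexHull ℝ (T : Set Plane)).combo_self_interior_mem_interior
    (subset_convexHull ℝ _ hz) hw (a := 1 - t / s) (b := t / s)
    (by rw [sub_nonneg, div_le_one hs]; exact hts) (by positivity) (by ring)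
  have e : (1 - t / s) • z + (t / s) • (z + s • w) = z + t • w := by
    have : t = t / s * s := by field_simp
    conv_rhs => rw [this]
    module
  rwa [e] at this

end Triangulation

namespace VertexEnumeration
open Triangulation
variable {Ω : Set Plane} {M : Triangulation Ω} (e : VertexEnumeration M) {ρ : ℝ} {z : Plane}

lemma mem_triangle (z : Plane) (j : ℕ) : z ∈ e.triangle z j := by simp [triangle, tri]

/-- Rescaled about `z` to diameter one, each triangle contains a disc of radius `ρ / 2` inside the
unit disc. A common point of two discs, scaled by the smaller diameter, would lie in the interiors
of both triangles, so the discs are disjoint and their areas add up to at most that of the unit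
disc. -/
lemma num_mul_sq_le (hρ : 0 < ρ) (hM : M.ShapeRegular ρ) (hz : z ∈ M.vertexSet) :
    e.num z * (ρ / 2) ^ 2 ≤ 1 := by
  have hc : ∀ j, ∃ c : Plane, j < e.num z → ∀ w ∈ Metric.ball c (ρ / 2),
      z + triDiam (e.triangle z j) • w ∈
        interior (convexHull ℝ (e.triangle z j : Set Plane)) := by
    intro j
    by_cases hj : j < e.num z
    · obtain ⟨c, r, hb, hr⟩ := hM _ (e.triangle_mem hz hj)
      have hD := triDiam_pos (e.triangle_mem hz hj)
      have hr : ρ * triDiam (e.triangle z j) ≤ 2 * r := hr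
      set D := triDiam (e.triangle z j)
      refine ⟨D⁻¹ • (c - z), fun _ w hw => ?_⟩
      refine interior_mono hb (Metric.ball_subset_interior_closedBall ?_)
      rw [Metric.mem_ball, dist_eq_norm] at hw ⊢
      have : z + D • w - c = D • (w - D⁻¹ • (c - z)) := by
        rw [smul_sub, smul_smul, mul_inv_cancel₀ hD.ne', one_smul]; abel
      rw [this, norm_smul, Real.norm_of_nonneg hD.le]
      nlinarith
    · exact ⟨0, fun h => absurd h hj⟩
  choose c hc using hc
  have hdisj : Set.PairwiseDisjoint (Finset.range (e.num z) : Set ℕ)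
      fun j => Metric.ball (c j) (ρ / 2) := by
    intro i hi j hj hij
    have hi := Finset.mem_range.1 hi
    have hj := Finset.mem_range.1 hj
    refine Set.disjoint_left.2 fun w hwi hwj => ?_
    have hDi := triDiam_pos (e.triangle_mem hz hi)
    have hDj := triDiam_pos (e.triangle_mem hz hj)
    have h1 := add_smul_mem_interior (e.mem_triangle z i) (lt_min hDi hDj) (min_le_left _ _)
      (hc i hi w hwi)
    have h2 := add_smul_mem_interior (e.mem_triangle z j) (lt_min hDi hDj) (min_le_right _ _)
      (hc j hj w hwj)
    exact Set.disjoint_left.1 (interior_disjoint (e.triangle_mem hz hi) (e.triangle_mem hz hj)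
      fun h => hij (e.injective z hz i hi j hj h)) h1 h2
  have hsub : (⋃ j ∈ Finset.range (e.num z), Metric.ball (c j) (ρ / 2)) ⊆
      Metric.closedBall (0 : Plane) 1 := by
    refine Set.iUnion₂_subset fun j hj w hw => ?_
    have hj := Finset.mem_range.1 hj
    have hD := triDiam_pos (e.triangle_mem hz hj)
    have := hull_subset_closedBall (e.mem_triangle z j) (interior_subset (hc j hj w hw))
    rw [Metric.mem_closedBall, dist_eq_norm, add_sub_cancel_left, norm_smul,
      Real.norm_of_nonneg hD.le] at this
    rw [mem_closedBall_zero_iff]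
    by_contra hcon
    nlinarith
  have h1 := measureReal_mono (μ := volume) hsub measure_closedBall_lt_top.ne
  rw [measureReal_biUnion_finset hdisj (fun _ _ => measurableSet_ball)
    (fun _ _ => measure_ball_lt_top.ne), volume_real_closedBall _ zero_le_one] at h1
  simp only [volume_real_ball _ (half_pos hρ).le, Finset.sum_const, Finset.card_range,
    nsmul_eq_mul] at h1
  have := unitArea_pos
  rw [← mul_assoc] at h1
  have := le_of_mul_le_mul_right h1 this
  simpa using this

/-- Consecutive triangles share an edge, which is comparable to both diameters; each step of the
walk costs a factor `ρ`. -/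
lemma pow_mul_triDiam_le (hρ : 0 < ρ) (hM : M.ShapeRegular ρ) (hz : z ∈ M.vertexSet) {i : ℕ}
    (n : ℕ) (hn : i + n < e.num z) :
    ρ ^ n * triDiam (e.triangle z i) ≤ triDiam (e.triangle z (i + n)) ∧
      ρ ^ n * triDiam (e.triangle z (i + n)) ≤ triDiam (e.triangle z i) := by
  induction n with
  | zero => simp
  | succ n ih =>
    obtain ⟨h1, h2⟩ := ih (by omega)
    have e1 : e.triangle z (i + n) = tri z (e.nbr z (i + n + 1)) (e.nbr z (i + n)) :=
      tri_swap _ _ _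
    have e2 : e.triangle z (i + (n + 1)) =
      tri z (e.nbr z (i + n + 1)) (e.nbr z (i + n + 1 + 1)) := rfl
    have h3 : ρ * triDiam (e.triangle z (i + n)) ≤ triDiam (e.triangle z (i + (n + 1))) := by
      rw [e1, e2]
      exact triDiam_adjacent hρ hM (e1 ▸ e.triangle_mem hz (by omega))
    have h4 : ρ * triDiam (e.triangle z (i + (n + 1))) ≤ triDiam (e.triangle z (i + n)) := by
      rw [e1, e2]
      exact triDiam_adjacent hρ hM (e2 ▸ e.triangle_mem hz (by omega))
    constructor
    · calc ρ ^ (n + 1) * triDiam (e.triangle z i) = ρ * (ρ ^ n * triDiam (e.triangle z i)) := by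
            ring
        _ ≤ ρ * triDiam (e.triangle z (i + n)) := by gcongr
        _ ≤ _ := h3
    · calc ρ ^ (n + 1) * triDiam (e.triangle z (i + (n + 1))) =
            ρ ^ n * (ρ * triDiam (e.triangle z (i + (n + 1)))) := by ring
        _ ≤ ρ ^ n * triDiam (e.triangle z (i + n)) := by gcongr
        _ ≤ _ := h2

lemma pow_mul_triDiam_le_triDiam (hρ : 0 < ρ) (hM : M.ShapeRegular ρ) (hz : z ∈ M.vertexSet)
    {i j n : ℕ} (hi : i < e.num z) (hj : j < e.num z) (hn : e.num z ≤ n) :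
    ρ ^ n * triDiam (e.triangle z i) ≤ triDiam (e.triangle z j) := by
  have hρ1 := shape_le_one hρ hM (e.triangle_mem hz hi)
  have hD := triDiam_pos (e.triangle_mem hz hi)
  rcases le_total i j with h | h
  · obtain ⟨m, rfl⟩ := Nat.exists_eq_add_of_le h
    refine le_trans ?_ (e.pow_mul_triDiam_le hρ hM hz m hj).1
    exact mul_le_mul_of_nonneg_right (pow_le_pow_of_le_one hρ.le hρ1 (by omega)) hD.le
  · obtain ⟨m, rfl⟩ := Nat.exists_eq_add_of_le h
    refine le_trans ?_ (e.pow_mul_triDiam_le hρ hM hz m hi).2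
    exact mul_le_mul_of_nonneg_right (pow_le_pow_of_le_one hρ.le hρ1 (by omega)) hD.le

lemma patch_subset_closedBall (hρ : 0 < ρ) (hM : M.ShapeRegular ρ) (hz : z ∈ M.vertexSet)
    {j n : ℕ} (hj : j < e.num z) (hn : e.num z ≤ n) :
    M.patch z ⊆ Metric.closedBall z (triDiam (e.triangle z j) / ρ ^ n) := by
  refine Set.iUnion₂_subset fun T hT => ?_
  obtain ⟨i, hi, hTi⟩ := e.surjective z hz T hT
  refine (hull_subset_closedBall hT.2).trans (Metric.closedBall_subset_closedBall ?_)
  rw [le_div_iff₀ (by positivity), hTi, mul_comm]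
  exact e.pow_mul_triDiam_le_triDiam hρ hM hz hi hj hn

/-- The area of the patch is comparable to the area of each of its triangles. -/
lemma volume_patch_le (hρ : 0 < ρ) (hM : M.ShapeRegular ρ) (hz : z ∈ M.vertexSet)
    {j n : ℕ} (hj : j < e.num z) (hn : e.num z ≤ n) :
    volume.real (M.patch z) ≤
      (2 / (ρ * ρ ^ n)) ^ 2 * volume.real (convexHull ℝ (e.triangle z j : Set Plane)) := by
  have hD := triDiam_pos (e.triangle_mem hz hj)
  obtain ⟨c, r, hb, hr⟩ := hM _ (e.triangle_mem hz hj)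
  have hr : ρ * triDiam (e.triangle z j) ≤ 2 * r := hr
  have hr0 : 0 < r := by nlinarith [mul_pos hρ hD]
  have h1 := measureReal_mono (μ := volume) (e.patch_subset_closedBall hρ hM hz hj hn)
    measure_closedBall_lt_top.ne
  have h2 := measureReal_mono (μ := volume) hb (isCompact_hull _).measure_lt_top.ne
  rw [volume_real_closedBall _ (by positivity)] at h1
  rw [volume_real_closedBall _ hr0.le] at h2
  refine h1.trans (le_trans ?_ (mul_le_mul_of_nonneg_left h2 (sq_nonneg _)))
  rw [← mul_assoc, ← mul_pow]
  have := unitArea_pos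
  gcongr
  rw [div_mul_eq_mul_div, div_le_div_iff₀ (by positivity) (by positivity)]
  nlinarith [mul_le_mul_of_nonneg_right hr (by positivity : 0 ≤ ρ ^ n)]

end VertexEnumeration

/-! ### Norms on the patch -/

section
variable {Ω : Set Plane} {M : Triangulation Ω} {z : Plane}

lemma finite_trianglesAt (M : Triangulation Ω) (z : Plane) : (M.trianglesAt z).Finite :=
  M.finite_faces.subset fun _ h => h.1.1

lemma isCompact_patch (M : Triangulation Ω) (z : Plane) : IsCompact (M.patch z) :=
  (finite_trianglesAt M z).isCompact_biUnion fun T _ => Triangulation.isCompact_hull T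

lemma ae_patch {P : Plane → Prop} (h : ∀ T ∈ M.trianglesAt z,
    ∀ x ∈ interior (convexHull ℝ (T : Set Plane)), P x) :
    ∀ᵐ x ∂volume.restrict (M.patch z), P x := by
  rw [Triangulation.patch, ae_restrict_biUnion_iff _ (finite_trianglesAt M z).countable]
  intro T hT
  filter_upwards [ae_mem_interior_hull T] with x hx using h T hT x hx

lemma abs_partialDeriv_le (v : Plane → Plane) (i j : Fin 2) (x : Plane) :
    |partialDeriv v i j x| ≤ ‖fderiv ℝ v x‖ := by
  have h1 := PiLp.norm_apply_le (fderiv ℝ v x (EuclideanSpace.single j 1)) i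
  have h2 := (fderiv ℝ v x).le_opNorm (EuclideanSpace.single j 1)
  rw [show ‖(EuclideanSpace.single j 1 : Plane)‖ = 1 by simp, mul_one] at h2
  exact h1.trans h2

/-- Each of the four partial derivatives is at most `B`, so the sum of their squares is at most `(2
* B) ^ 2`. -/
lemma IsCorrector.gradNormL2_le {k : ℕ} {B : ℝ} {d : Finset Plane → ℝ} {v : Plane → Plane}
    (h : IsCorrector M z k B d v) (hB : 0 ≤ B) :
    gradNormL2 (M.patch z) v ≤ 2 * B * Real.sqrt (volume.real (M.patch z)) := by
  have hle : ∫ x in M.patch z, ∑ i, ∑ j, partialDeriv v i j x ^ 2 ≤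
      ∫ _ in M.patch z, (2 * B) ^ 2 := by
    refine integral_mono_of_nonneg (Filter.Eventually.of_forall fun x => by positivity)
      (integrableOn_const (isCompact_patch M z).measure_lt_top.ne) (ae_patch fun T hT x hx => ?_)
    have hb := (h.localCorrector T hT.1).bound x hx
    have h2 : ∀ i j, partialDeriv v i j x ^ 2 ≤ B ^ 2 := fun i j =>
      sq_le_sq' (by linarith [(abs_le.1 ((abs_partialDeriv_le v i j x).trans hb)).1])
        (abs_le.1 ((abs_partialDeriv_le v i j x).trans hb)).2
    simp only [Fin.sum_univ_two]
    linarith [h2 0 0, h2 0 1, h2 1 0, h2 1 1]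
  rw [setIntegral_const, smul_eq_mul] at hle
  rw [gradNormL2]
  refine (Real.sqrt_le_sqrt hle).trans (le_of_eq ?_)
  rw [Real.sqrt_mul measureReal_nonneg, Real.sqrt_sq (by positivity)]; ring

/-- A vertex lies in the closure of the interior of its triangle, so the limit defining `extendFrom`
there is unique. -/
lemma valueOn_eq {T : Finset Plane} (hT : T ∈ M.triangles) {q : Plane → ℝ} {x : Plane} {c : ℝ}
    (hx : x ∈ T)
    (h : Filter.Tendsto q (𝓝[interior (convexHull ℝ (T : Set Plane))] x) (𝓝 c)) :
    valueOn T q x = c := by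
  refine extendFrom_eq ?_ h
  rw [Triangulation.closure_interior_hull hT]
  exact subset_convexHull ℝ _ hx

lemma IsCorrector.mem_velocitySpace {k : ℕ} {B : ℝ} {d : Finset Plane → ℝ} {v : Plane → Plane}
    (h : IsCorrector M z k B d v) : v ∈ velocitySpace M k :=
  ⟨h.continuous, h.eq_zero, fun T hT => (h.localCorrector T hT).poly⟩

/-- The vertex values of a piecewise polynomial are bounded by its norm on the patch. -/
lemma exists_abs_valueOn_le (m : ℕ) {ρ : ℝ} (hρ : 0 < ρ) (n : ℕ) : ∃ C : ℝ, 0 < C ∧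
    ∀ (Ω : Set Plane) (M : Triangulation Ω) (e : VertexEnumeration M) (z : Plane) (q : Plane → ℝ),
      M.ShapeRegular ρ → z ∈ M.vertexSet → e.num z ≤ n →
      (∀ T ∈ M.triangles, IsPolyOn (interior (convexHull ℝ (T : Set Plane))) m q) →
      ∀ j < e.num z, |valueOn (e.triangle z j) q z| * Real.sqrt (volume.real (M.patch z)) ≤
        C * normL2 (M.patch z) q := by
  obtain ⟨C, hC, hC'⟩ := exists_inverse_inequality m
  refine ⟨2 / (ρ * ρ ^ n) * Real.sqrt C, by positivity, ?_⟩
  intro Ω M e z q hM hz hn hq j hj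
  have hT := e.triangle_mem hz hj
  have hTz : e.triangle z j ∈ M.trianglesAt z := ⟨hT, e.mem_triangle z j⟩
  obtain ⟨P, hP, hPq⟩ := hq _ hT
  have hval : valueOn (e.triangle z j) q z = MvPolynomial.eval (fun i => z i) P := by
    refine valueOn_eq hT (e.mem_triangle z j) ?_
    have h1 := ((continuous_eval P).tendsto z).mono_left
      (nhdsWithin_le_nhds (s := interior (convexHull ℝ (e.triangle z j : Set Plane))))
    exact h1.congr' (eventually_nhdsWithin_of_forall fun x hx => (hPq x hx).symm)
  have hint : ∀ T ∈ M.trianglesAt z,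
      IntegrableOn (fun x => q x ^ 2) (convexHull ℝ (T : Set Plane)) := by
    intro T hT
    obtain ⟨Q, -, hQ⟩ := hq T hT.1
    have h1 : IntegrableOn (fun x : Plane => MvPolynomial.eval (fun i => x i) Q ^ 2)
        (convexHull ℝ (T : Set Plane)) :=
      ((continuous_eval Q).pow 2).continuousOn.integrableOn_compact (Triangulation.isCompact_hull T)
    refine h1.congr ?_
    filter_upwards [ae_mem_interior_hull T] with x hx
    rw [hQ x hx]
  have hle : ∫ x in convexHull ℝ (e.triangle z j : Set Plane),
      MvPolynomial.eval (fun i => x i) P ^ 2 ≤ ∫ x in M.patch z, q x ^ 2 := by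
    have h1 : ∫ x in convexHull ℝ (e.triangle z j : Set Plane),
        MvPolynomial.eval (fun i => x i) P ^ 2 =
        ∫ x in convexHull ℝ (e.triangle z j : Set Plane), q x ^ 2 := by
      refine integral_congr_ae ?_
      filter_upwards [ae_mem_interior_hull (e.triangle z j)] with x hx
      rw [hPq x hx]
    rw [h1]
    refine setIntegral_mono_set ?_ (Filter.Eventually.of_forall fun x => sq_nonneg _) ?_
    · exact (integrableOn_finite_biUnion (finite_trianglesAt M z)).2 hint
    · exact (Set.subset_biUnion_of_mem
        (u := fun T : Finset Plane => convexHull ℝ (T : Set Plane)) hTz).eventuallyLE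
  have hinv := hC' z _ _ (Triangulation.cross_ne_zero hT) P hP
  have hvol := e.volume_patch_le hρ hM hz hj hn
  rw [hval, normL2, ← Real.sqrt_sq_eq_abs, ← Real.sqrt_mul (sq_nonneg _), mul_assoc,
    ← Real.sqrt_mul hC.le]
  have hκ : 0 ≤ 2 / (ρ * ρ ^ n) := by positivity
  rw [← Real.sqrt_sq hκ, ← Real.sqrt_mul (sq_nonneg _)]
  refine Real.sqrt_le_sqrt ?_
  calc _ ≤ MvPolynomial.eval (fun i => z i) P ^ 2 * ((2 / (ρ * ρ ^ n)) ^ 2 *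
        volume.real (convexHull ℝ (e.triangle z j : Set Plane))) := by gcongr
    _ = (2 / (ρ * ρ ^ n)) ^ 2 * (volume.real (convexHull ℝ (e.triangle z j : Set Plane)) *
        MvPolynomial.eval (fun i => z i) P ^ 2) := by ring
    _ ≤ (2 / (ρ * ρ ^ n)) ^ 2 * (C * ∫ x in M.patch z, q x ^ 2) := by
      refine mul_le_mul_of_nonneg_left ?_ (sq_nonneg _)
      exact hinv.trans (mul_le_mul_of_nonneg_left hle hC.le)

lemma volume_patch_pos (e : VertexEnumeration M) (hz : z ∈ M.vertexSet) :
    0 < volume.real (M.patch z) := by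
  have hj := e.num_pos hz
  have hT := e.triangle_mem hz hj
  have hsub : interior (convexHull ℝ (e.triangle z 0 : Set Plane)) ⊆ M.patch z :=
    interior_subset.trans (Set.subset_biUnion_of_mem
      (u := fun T : Finset Plane => convexHull ℝ (T : Set Plane))
      (show e.triangle z 0 ∈ M.trianglesAt z from ⟨hT, e.mem_triangle z 0⟩))
  have h1 : 0 < volume (interior (convexHull ℝ (e.triangle z 0 : Set Plane))) :=
    isOpen_interior.measure_pos _ (interior_hull_nonempty (Triangulation.cross_ne_zero hT))
  exact ENNReal.toReal_pos (h1.trans_le (measure_mono hsub)).ne'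
    (isCompact_patch M z).measure_lt_top.ne

lemma VertexEnumeration.Gam_nonneg (e : VertexEnumeration M) (z : Plane) : 0 ≤ e.Gam z :=
  Real.iSup_nonneg fun _ => abs_nonneg _

end

/-! ### Assembly of the result -/

lemma IsCorrector.spec {Ω : Set Plane} {M : Triangulation Ω} {z : Plane}
    {k : ℕ} {B : ℝ} {p : Plane → ℝ} {d : Finset Plane → ℝ} {v : Plane → Plane}
    (e : VertexEnumeration M) (hz : z ∈ M.vertexSet) (h : IsCorrector M z k B d v)
    (hd : ∀ i < e.num z, d (e.triangle z i) = valueOn (e.triangle z i) p z) :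
    (∀ T ∈ M.triangles, ∀ σ ∈ T, σ ≠ z → valueOn T (divergence v) σ = 0) ∧
    (∀ T ∈ M.trianglesAt z, valueOn T (divergence v) z = valueOn T p z) ∧
    tsupport v ⊆ M.patch z ∧
    (∀ K ∈ M.triangles, ∫ x in convexHull ℝ (K : Set Plane), divergence v x = 0) := by
  refine ⟨fun T hT σ hσ hne => valueOn_eq hT hσ ((h.localCorrector T hT).tendsto_other σ hσ hne),
    fun T hT => ?_, h.support, fun K hK => (h.localCorrector K hK).integral⟩
  obtain ⟨i, hi, rfl⟩ := e.surjective z hz T hT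
  rw [valueOn_eq hT.1 hT.2 ((h.localCorrector _ hT.1).tendsto_vertex hT.2)]
  exact hd i hi

end

end ScottVogelius

theorem lemma3p4 (k : ℕ) (hk : 1 ≤ k) (ρ : ℝ) (hρ : 0 < ρ) :
    ∃ C : ℝ, 0 < C ∧
      ∀ (Ω : Set ScottVogelius.Plane), ScottVogelius.IsRegularDomain Ω →
      ∀ (M : ScottVogelius.Triangulation Ω) (e : ScottVogelius.VertexEnumeration M),
        M.ShapeRegular ρ →
      ∀ p ∈ ScottVogelius.pressureSpace e (k - 1), ∀ z ∈ M.vertexSet,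
      ∃ v : ScottVogelius.Plane → ScottVogelius.Plane,
        (∀ T ∈ M.triangles, ∀ σ ∈ T, σ ≠ z →
          ScottVogelius.valueOn T (ScottVogelius.divergence v) σ = 0) ∧
        (∀ T ∈ M.trianglesAt z,
          ScottVogelius.valueOn T (ScottVogelius.divergence v) z
            = ScottVogelius.valueOn T p z) ∧
        tsupport v ⊆ M.patch z ∧
        (∀ K ∈ M.triangles,
          ∫ x in convexHull ℝ (K : Set ScottVogelius.Plane),
            ScottVogelius.divergence v x = 0) ∧
        (e.IsSingular z →
          v ∈ ScottVogelius.velocitySpace M 3 ∧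
          ScottVogelius.gradNormL2 (M.patch z) v
            ≤ C * ScottVogelius.normL2 (M.patch z) p) ∧
        (e.IsNonsingular z →
          v ∈ ScottVogelius.velocitySpace M 4 ∧
          ScottVogelius.gradNormL2 (M.patch z) v
            ≤ C * (1 / e.Theta z + 1) * ScottVogelius.normL2 (M.patch z) p) := by
  -- By the area count, `n` bounds the number of triangles at any vertex.
  obtain ⟨n, hn⟩ := exists_nat_ge (1 / (ρ / 2) ^ 2)
  obtain ⟨K, hK, hK'⟩ := ScottVogelius.exists_abs_valueOn_le (k - 1) hρ n
  have hρ' : 0 < 1 / ρ := by positivity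
  -- This is the gradient bound of `exists_corrector_of_nonsingular` with `n` triangles, `A = 1` and
  -- `Θ(z) = 1`; it also dominates the singular case.
  set G : ℝ := n * (7 * (1 / ρ)) + 3 * n ^ 2 * (1 + n * (1 + 1 / ρ)) * (1 / ρ) with hG
  have hG0 : 0 ≤ G := by positivity
  refine ⟨2 * G * K + 1, by positivity, fun Ω hΩ M e hM p hp z hz => ?_⟩
  obtain ⟨-, -, hpoly, hsing⟩ := hp
  have hNn : e.num z ≤ n := by
    have := e.num_mul_sq_le hρ hM hz
    rw [← le_div_iff₀ (by positivity)] at this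
    exact_mod_cast this.trans hn
  have hNn' : (e.num z : ℝ) ≤ n := by exact_mod_cast hNn
  have hV := ScottVogelius.volume_patch_pos e hz
  set V := Real.sqrt (volume.real (M.patch z)) with hVdef
  have hV0 : 0 < V := Real.sqrt_pos.2 hV
  have hq0 : 0 ≤ ScottVogelius.normL2 (M.patch z) p := Real.sqrt_nonneg _
  -- `A` bounds the vertex values of `p`; its denominator cancels the root of the patch area in
  -- `gradNormL2_le`.
  set A := K * ScottVogelius.normL2 (M.patch z) p / V with hA
  have hA0 : 0 ≤ A := by positivity
  have hAV : A * V = K * ScottVogelius.normL2 (M.patch z) p := by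
    rw [hA]; field_simp
  have ha : ∀ j < e.num z, |ScottVogelius.valueOn (e.triangle z j) p z| ≤ A := fun j hj =>
    (le_div_iff₀ hV0).2 (hK' Ω M e z p hM hz hNn hpoly j hj)
  by_cases hs : e.IsSingular z
  · obtain ⟨d, v, hv, hd⟩ := e.exists_corrector_of_altPart hΩ hρ hM hz ha (hsing z hz hs)
    obtain ⟨h1, h2, h3, h4⟩ := hv.spec e hz hd
    refine ⟨v, h1, h2, h3, h4, fun _ => ⟨hv.mem_velocitySpace, ?_⟩, fun hns => ?_⟩
    · refine (hv.gradNormL2_le (by positivity)).trans ?_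
      have hle : 3 * (e.num z : ℝ) ^ 2 * A * (1 / ρ) ≤ G * A := by
        have h5 : 3 * (e.num z : ℝ) ^ 2 * (1 / ρ) ≤ 3 * n ^ 2 * (1 / ρ) := by gcongr
        have h6 : 3 * (n : ℝ) ^ 2 * (1 / ρ) ≤ G := by
          have : 0 ≤ (n : ℝ) * (7 * (1 / ρ)) + 3 * n ^ 2 * (n * (1 + 1 / ρ)) * (1 / ρ) := by
            positivity
          rw [hG]; linarith
        nlinarith
      calc _ ≤ 2 * (G * A) * V := by gcongr
        _ = 2 * G * (A * V) := by ring
        _ ≤ _ := by rw [hAV]; nlinarith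
    · rw [ScottVogelius.VertexEnumeration.IsNonsingular, show e.Gam z = 0 from hs] at hns
      exact absurd hns (lt_irrefl _)
  · have hns : e.IsNonsingular z := lt_of_le_of_ne (e.Gam_nonneg z) (Ne.symm hs)
    obtain ⟨hΘ, -⟩ := e.exists_Theta_eq hz hns
    obtain ⟨d, v, hv, hd⟩ := e.exists_corrector_of_nonsingular hΩ hρ hM hz hns ha
    obtain ⟨h1, h2, h3, h4⟩ := hv.spec e hz hd
    refine ⟨v, h1, h2, h3, h4, fun h => absurd h hs, fun _ => ⟨hv.mem_velocitySpace, ?_⟩⟩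
    refine (hv.gradNormL2_le (by positivity)).trans ?_
    set t := 1 / e.Theta z with ht
    have ht0 : 0 < t := by positivity
    have e1 : e.num z * A / e.Theta z = e.num z * A * t := by rw [ht]; ring
    rw [e1]
    -- Both 1 and `t` are at most `t + 1`, which factors out of every term.
    have hle : e.num z * A * t * (7 * (1 / ρ)) +
        3 * (e.num z : ℝ) ^ 2 * (A + e.num z * A * t * (1 + 1 / ρ)) * (1 / ρ) ≤
        G * (t + 1) * A := by
      calc _ ≤ n * A * t * (7 * (1 / ρ)) +
          3 * (n : ℝ) ^ 2 * (A + n * A * t * (1 + 1 / ρ)) * (1 / ρ) := by gcongr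
        _ ≤ n * A * (t + 1) * (7 * (1 / ρ)) +
          3 * (n : ℝ) ^ 2 * (A * (t + 1) + n * A * (t + 1) * (1 + 1 / ρ)) * (1 / ρ) := by
          gcongr <;> nlinarith
        _ = _ := by rw [hG]; ring
    calc _ ≤ 2 * (G * (t + 1) * A) * V := by gcongr
      _ = 2 * G * (t + 1) * (A * V) := by ring
      _ ≤ _ := by
        rw [hAV]
        nlinarith [mul_nonneg (by positivity : 0 ≤ t + 1) hq0]
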